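/- Let $R=\mathbb R$ or $\mathbb C$. Let $\mathscr V$ be either the category $\mathbf{SNorm}_1$ of seminormed vector spaces over $R$ with nonexpansive linear maps, or its full subcategory $\mathbf{Norm}_1$ of normed vector spaces. $\mathscr V$ is symmetric monoidal closed: $V\otimes W$ is the algebraic tensor product with the projective seminorm $\|x\|=\inf\{\sum_i\|v_i\|\|w_i\| : x=\sum_i v_i\otimes w_i\}$, the unit object is $R$, and the internal hom $\underline{\mathscr V}(V,W)$ is the space of bounded linear maps $V\to W$ with the operator seminorm. Let $\underline{\mathscr V}$ be the resulting $\mathscr V$-category, and write $V^*=\underline{\mathscr V}(V,R)$. Let $\mathbb T$ be the double-dualization $\mathscr V$-monad on $\underline{\mathscr V}$, i.e. the $\mathscr V$-monad $V\mapsto V^{**}$ induced by the dualization $\mathscr V$-adjunction $(-)^*\dashv(-)^*:\underline{\mathscr V}^{\mathrm{op}}\to\underline{\mathscr V}$. Let $\mathbf{Ban}_1\hookrightarrow\underline{\mathscr V}$ be the full sub-$\mathscr V$-category of Banach spaces, and let $\widetilde{\mathbb T}$ be the completion $\mathscr V$-monad, i.e. the $\mathscr V$-monad $V\mapsto\widetilde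 V$ induced by the $\mathscr V$-adjunction $\widetilde{(-)}\dashv J:\mathbf{Ban}_1\hookrightarrow\underline{\mathscr V}$, where $\widetilde V$ is the Cauchy completion of $V$. For a $\mathscr V$-monad $\mathbb S$ with underlying endofunctor $S$, let $\Sigma_S$ be the class of morphisms $h$ of $\mathscr V$ such that $Sh$ is an isomorphism. An idempotent $\mathscr V$-core of $\mathbb T$ is an idempotent $\mathscr V$-monad $\mathbb S$ (its multiplication is an isomorphism) with $\Sigma_S=\Sigma_T$. For a morphism $h:V\to W$ and an object $B$, write $h\perp_{\mathscr V}B$ if $\underline{\mathscr V}(h,B):\underline{\mathscr V}(W,B)\to\underline{\mathscr V}(V,B)$ is an isomorphism in $\mathscr V$. A $\mathscr V$-reflective subcategory is a full replete sub-$\mathscr V$-category whose inclusion has a left $\mathscr V$-adjoint. Then the following hold. (a) $\widetilde{\mathbb T}$ is an idempotent $\mathscr V$-core of $\mathbb T$. (b) $\Sigma_T=\Sigma_{\widetilde T}$ is the class of all morphisms $h$ of $\mathscr V$ that are dense (the image of $h$ is dense) and isometric ($\|h(v)\|=\|v\|$ for all $v$). (c) $\mathbf{Ban}_1$ is the $\mathscr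 V$-reflective hull of $R$ in $\underline{\mathscr V}$, i.e. the smallest $\mathscr V$-reflective subcategory of $\underline{\mathscr V}$ that contains $R$. (d) Let $B$ be an object of $\mathscr V$. For each morphism $h:V\to W$ of $\mathscr V$ the following two conditions are equivalent: 1. if $h\perp_{\mathscr V}R$, then $h\perp_{\mathscr V}B$; 2. if $h^*:W^*\to V^*$ is an isomorphism in $\mathscr V$, then $\underline{\mathscr V}(h,B):\underline{\mathscr V}(W,B)\to\underline{\mathscr V}(V,B)$ is an isomorphism in $\mathscr V$. Moreover $B$ is a Banach space if and only if condition 1 holds for every morphism $h$ of $\mathscr V$, and likewise if and only if condition 2 holds for every morphism $h$ of $\mathscr V$. -/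

import Mathlib

open CategoryTheory MonoidalCategory
open scoped TensorProduct CategoryTheory.MonoidalClosed

universe u

noncomputable section

namespace NormedCompletion

/-! ## `V`-functors, `V`-adjunctions and `V`-monads -/

section Enriched

universe w v v₁ v₂ v₃ u₁ u₂ u₃

variable {V : Type v} [Category.{w} V] [MonoidalCategory V]
  {B : Type u₁} [Category.{v₁} B] [EnrichedOrdinaryCategory V B]
  {C : Type u₂} [Category.{v₂} C] [EnrichedOrdinaryCategory V C]
  {D : Type u₃} [Category.{v₃} D] [EnrichedOrdinaryCategory V D]

/-- The action of a `V`-functor on the morphisms of the underlying ordinary categories. -/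
def underMap (F : EnrichedFunctor V B C) {X Y : B} (f : X ⟶ Y) : F.obj X ⟶ F.obj Y :=
  (eHomEquiv V).symm (eHomEquiv V f ≫ F.map X Y)

lemma eHomEquiv_underMap (F : EnrichedFunctor V B C) {X Y : B} (f : X ⟶ Y) :
    eHomEquiv V (underMap F f) = eHomEquiv V f ≫ F.map X Y :=
  (eHomEquiv V).apply_symm_apply _

lemma underMap_id (F : EnrichedFunctor V B C) (X : B) : underMap F (𝟙 X) = 𝟙 (F.obj X) :=
  (eHomEquiv V).injective (by rw [eHomEquiv_underMap]; simp)

lemma underMap_comp (F : EnrichedFunctor V B C) {X Y Z : B} (f : X ⟶ Y) (g : Y ⟶ Z) :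
    underMap F (f ≫ g) = underMap F f ≫ underMap F g :=
  (eHomEquiv V).injective (by
    rw [eHomEquiv_underMap, eHomEquiv_comp, eHomEquiv_comp, eHomEquiv_underMap,
      eHomEquiv_underMap, ← tensorHom_comp_tensorHom]
    simp)

lemma underMap_comp_functor (F : EnrichedFunctor V B C) (G : EnrichedFunctor V C D) {X Y : B}
    (f : X ⟶ Y) : underMap (F.comp V G) f = underMap G (underMap F f) :=
  (eHomEquiv V).injective (by
    rw [eHomEquiv_underMap]
    refine Eq.trans ?_ (eHomEquiv_underMap G (underMap F f)).symm
    rw [eHomEquiv_underMap]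
    exact (Category.assoc _ _ _).symm)

lemma underMap_id_functor {X Y : B} (f : X ⟶ Y) :
    underMap (EnrichedFunctor.id V B) f = f :=
  (eHomEquiv V).injective (by
    rw [eHomEquiv_underMap]
    exact Category.comp_id _)

/-- `V`-naturality of a family of morphisms between the values of two `V`-functors. -/
def VNatural (F G : EnrichedFunctor V B C) (α : ∀ X, F.obj X ⟶ G.obj X) : Prop :=
  ∀ X Y : B, F.map X Y ≫ eHomWhiskerLeft V (F.obj X) (α Y) =
    G.map X Y ≫ eHomWhiskerRight V (α X) (G.obj Y)

lemma eHomWhiskerLeft_map (F : EnrichedFunctor V B C) (X : B) {Y Z : B} (g : Y ⟶ Z) :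
    eHomWhiskerLeft V X g ≫ F.map X Z =
      F.map X Y ≫ eHomWhiskerLeft V (F.obj X) (underMap F g) := by
  simp only [eHomWhiskerLeft, eHomEquiv_underMap, Category.assoc, EnrichedFunctor.map_comp,
    MonoidalCategory.whiskerLeft_comp]
  rw [rightUnitor_inv_naturality_assoc, ← whisker_exchange_assoc, tensorHom_def_assoc,
    whisker_exchange_assoc]

lemma eHomWhiskerRight_map (F : EnrichedFunctor V B C) {X Y : B} (f : X ⟶ Y) (Z : B) :
    eHomWhiskerRight V f Z ≫ F.map X Z =
      F.map Y Z ≫ eHomWhiskerRight V (underMap F f) (F.obj Z) := by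
  simp only [eHomWhiskerRight, eHomEquiv_underMap, Category.assoc, EnrichedFunctor.map_comp,
    comp_whiskerRight]
  rw [leftUnitor_inv_naturality_assoc, whisker_exchange_assoc, tensorHom_def_assoc]
  simp [whisker_exchange_assoc]

lemma eHomEquiv_eHomWhiskerLeft {X Y Z : B} (f : X ⟶ Y) (g : Y ⟶ Z) :
    eHomEquiv V f ≫ eHomWhiskerLeft V X g = eHomEquiv V (f ≫ g) := by
  rw [eHomEquiv_comp, eHomWhiskerLeft, rightUnitor_inv_naturality_assoc, tensorHom_def_assoc,
    unitors_inv_equal]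

lemma eHomEquiv_eHomWhiskerRight {X Y Z : B} (f : X ⟶ Y) (g : Y ⟶ Z) :
    eHomEquiv V g ≫ eHomWhiskerRight V f Z = eHomEquiv V (f ≫ g) := by
  rw [eHomEquiv_comp, eHomWhiskerRight, leftUnitor_inv_naturality_assoc, tensorHom_def'_assoc]

lemma VNatural.naturality {F G : EnrichedFunctor V B C} {α : ∀ X, F.obj X ⟶ G.obj X}
    (h : VNatural F G α) {X Y : B} (f : X ⟶ Y) :
    underMap F f ≫ α Y = α X ≫ underMap G f := by
  apply (eHomEquiv V).injective
  rw [← eHomEquiv_eHomWhiskerLeft, ← eHomEquiv_eHomWhiskerRight, eHomEquiv_underMap,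
    eHomEquiv_underMap, Category.assoc, Category.assoc, h X Y]

lemma VNatural.postcomp {F G : EnrichedFunctor V B C} {α : ∀ X, F.obj X ⟶ G.obj X}
    (h : VNatural F G α) (H : EnrichedFunctor V C D) :
    VNatural (F.comp V H) (G.comp V H) (fun X => underMap H (α X)) := by
  intro X Y
  have := congrArg (· ≫ H.map _ _) (h X Y)
  simp only [Category.assoc, eHomWhiskerLeft_map, eHomWhiskerRight_map] at this
  exact (Category.assoc _ _ _).trans (this.trans (Category.assoc _ _ _).symm)

lemma VNatural.precomp {F G : EnrichedFunctor V C D} {α : ∀ X, F.obj X ⟶ G.obj X}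
    (h : VNatural F G α) (H : EnrichedFunctor V B C) :
    VNatural (H.comp V F) (H.comp V G) (fun X => α (H.obj X)) := by
  intro X Y
  exact (Category.assoc _ _ _).trans ((congrArg (H.map X Y ≫ ·) (h (H.obj X) (H.obj Y))).trans
    (Category.assoc _ _ _).symm)

variable (V B) in
/-- A `V`-monad on a `V`-category: a `V`-endofunctor with `V`-natural unit and multiplication
satisfying the monad laws. -/
structure VMonad where
  T : EnrichedFunctor V B B
  unit : ∀ X : B, X ⟶ T.obj X
  mul : ∀ X : B, T.obj (T.obj X) ⟶ T.obj X
  unit_natural : VNatural (EnrichedFunctor.id V B) T unit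
  mul_natural : VNatural (T.comp V T) T mul
  unit_mul : ∀ X, unit (T.obj X) ≫ mul X = 𝟙 _
  map_unit_mul : ∀ X, underMap T (unit X) ≫ mul X = 𝟙 _
  assoc : ∀ X, underMap T (mul X) ≫ mul X = mul (T.obj X) ≫ mul X

/-- A `V`-monad is idempotent if its multiplication is an isomorphism. -/
def VMonad.IsIdempotent (S : VMonad V B) : Prop := ∀ X, IsIso (S.mul X)

/-- The class `Σ_S` of the morphisms that (the endofunctor of) a `V`-monad inverts. -/
def VMonad.inverted (S : VMonad V B) : MorphismProperty B := fun _ _ f => IsIso (underMap S.T f)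

/-- `S` is an idempotent `V`-core of `T`: it is an idempotent `V`-monad that inverts the same
morphisms as `T`. -/
def IsIdempotentCore (S T : VMonad V B) : Prop := S.IsIdempotent ∧ S.inverted = T.inverted

/-- A `V`-adjunction `F ⊣ G`, given by its unit and counit. -/
structure VAdjunction (F : EnrichedFunctor V B C) (G : EnrichedFunctor V C B) where
  unit : ∀ X : B, X ⟶ G.obj (F.obj X)
  counit : ∀ Y : C, F.obj (G.obj Y) ⟶ Y
  unit_natural : VNatural (EnrichedFunctor.id V B) (F.comp V G) unit
  counit_natural : VNatural (G.comp V F) (EnrichedFunctor.id V C) counit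
  left_triangle : ∀ X, underMap F (unit X) ≫ counit (F.obj X) = 𝟙 _
  right_triangle : ∀ Y, unit (G.obj Y) ≫ underMap G (counit Y) = 𝟙 _

/-- The `V`-monad induced by a `V`-adjunction. -/
def VAdjunction.toVMonad {F : EnrichedFunctor V B C} {G : EnrichedFunctor V C B}
    (adj : VAdjunction F G) : VMonad V B where
  T := F.comp V G
  unit := adj.unit
  mul X := underMap G (adj.counit (F.obj X))
  unit_natural := adj.unit_natural
  mul_natural X Y := by
    have := (adj.counit_natural.postcomp G).precomp F X Y
    simpa [EnrichedFunctor.comp, EnrichedFunctor.id] using this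
  unit_mul X := adj.right_triangle (F.obj X)
  map_unit_mul X := by
    refine (congrArg (· ≫ underMap G (adj.counit (F.obj X)))
      (underMap_comp_functor F G (adj.unit X))).trans ?_
    refine (underMap_comp G _ _).symm.trans ?_
    rw [adj.left_triangle, underMap_id]
    rfl
  assoc X := by
    refine (congrArg (· ≫ underMap G (adj.counit (F.obj X)))
      (underMap_comp_functor F G (underMap G (adj.counit (F.obj X))))).trans ?_
    refine (underMap_comp G _ _).symm.trans (Eq.trans ?_ (underMap_comp G _ _))
    refine congrArg (underMap G) ?_
    have h := adj.counit_natural.naturality (adj.counit (F.obj X))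
    refine Eq.trans ?_ (h.trans (congrArg (adj.counit (F.obj (G.obj (F.obj X))) ≫ ·)
      (underMap_id_functor _)))
    exact congrArg (· ≫ adj.counit (F.obj X)) (underMap_comp_functor G F _).symm

/-- `f` is `V`-orthogonal to `X`: precomposition with `f` is an isomorphism
`B(A₂, X) ⟶ B(A₁, X)` in `V`. -/
def VOrthogonal (V : Type v) [Category.{w} V] [MonoidalCategory V] [EnrichedOrdinaryCategory V B]
    {A₁ A₂ : B} (f : A₁ ⟶ A₂) (X : B) : Prop :=
  IsIso (eHomWhiskerRight V f X)

variable (V) in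
/-- The inclusion `V`-functor of a full sub-`V`-category. -/
def inclusion (P : ObjectProperty B) : EnrichedFunctor V P.FullSubcategory B where
  obj X := X.obj
  map X Y := 𝟙 (X.obj ⟶[V] Y.obj)
  map_id X := Category.comp_id _
  map_comp X Y Z := by
    refine (Category.comp_id _).trans ?_
    refine Eq.trans ?_ (congrArg (· ≫ eComp V X.obj Y.obj Z.obj) (id_tensorHom_id _ _).symm)
    exact (Category.id_comp _).symm

variable (V) in
/-- A full sub-`V`-category, given by its class of objects, is a `V`-reflective-subcategory if it
is replete and its inclusion `V`-functor has a left `V`-adjoint. -/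
def IsVReflective (P : ObjectProperty B) : Prop :=
  P.IsClosedUnderIsomorphisms ∧
    ∃ K : EnrichedFunctor V B P.FullSubcategory, Nonempty (VAdjunction K (inclusion V P))

variable (V) in
/-- `P` is the `V`-reflective hull of `Q`: the smallest `V`-reflective-subcategory that
contains `Q`. -/
def IsVReflectiveHull (Q P : ObjectProperty B) : Prop :=
  IsVReflective V P ∧ Q ≤ P ∧ ∀ P' : ObjectProperty B, IsVReflective V P' → Q ≤ P' → P ≤ P'

end Enriched

/-! ## The projective seminorm on the algebraic tensor product -/

section Projective

variable (𝕜 : Type*) [RCLike 𝕜]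
variable (V W Z : Type*) [SeminormedAddCommGroup V] [NormedSpace 𝕜 V]
  [SeminormedAddCommGroup W] [NormedSpace 𝕜 W] [SeminormedAddCommGroup Z] [NormedSpace 𝕜 Z]

variable {V W} in
/-- The set of all sums `∑ i, ‖v i‖ * ‖w i‖` over the finite representations
`x = ∑ i, v i ⊗ w i` of `x`. -/
def projSums (x : V ⊗[𝕜] W) : Set ℝ :=
  {r | ∃ (n : ℕ) (v : Fin n → V) (w : Fin n → W),
    x = ∑ i, v i ⊗ₜ[𝕜] w i ∧ r = ∑ i, ‖v i‖ * ‖w i‖}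

variable {V W} in
/-- The projective seminorm of an element of the tensor product. -/
def projNorm (x : V ⊗[𝕜] W) : ℝ := sInf (projSums 𝕜 x)

variable {𝕜 V W Z}

lemma projSums_nonneg {x : V ⊗[𝕜] W} {r : ℝ} (h : r ∈ projSums 𝕜 x) : 0 ≤ r := by
  obtain ⟨n, v, w, -, rfl⟩ := h
  positivity

lemma projSums_bddBelow (x : V ⊗[𝕜] W) : BddBelow (projSums 𝕜 x) :=
  ⟨0, fun _ h => projSums_nonneg h⟩

lemma projSums_add {x y : V ⊗[𝕜] W} {r s : ℝ} (hr : r ∈ projSums 𝕜 x) (hs : s ∈ projSums 𝕜 y) :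
    r + s ∈ projSums 𝕜 (x + y) := by
  obtain ⟨n, v, w, rfl, rfl⟩ := hr
  obtain ⟨m, v', w', rfl, rfl⟩ := hs
  refine ⟨n + m, Fin.append v v', Fin.append w w', ?_, ?_⟩
  · simp [Fin.sum_univ_add]
  · simp [Fin.sum_univ_add]

lemma projSums_smul {x : V ⊗[𝕜] W} {r : ℝ} (c : 𝕜) (hr : r ∈ projSums 𝕜 x) :
    ‖c‖ * r ∈ projSums 𝕜 (c • x) := by
  obtain ⟨n, v, w, rfl, rfl⟩ := hr
  refine ⟨n, fun i => c • v i, w, ?_, ?_⟩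
  · simp [Finset.smul_sum, TensorProduct.smul_tmul']
  · simp [Finset.mul_sum, norm_smul, mul_assoc]

lemma projSums_tmul (v : V) (w : W) : ‖v‖ * ‖w‖ ∈ projSums 𝕜 (v ⊗ₜ[𝕜] w) :=
  ⟨1, fun _ => v, fun _ => w, by simp, by simp⟩

lemma projSums_nonempty (x : V ⊗[𝕜] W) : (projSums 𝕜 x).Nonempty := by
  induction x with
  | zero => exact ⟨0, 0, 0, 0, by simp, by simp⟩
  | tmul v w => exact ⟨_, projSums_tmul v w⟩
  | add x y hx hy =>
    obtain ⟨r, hr⟩ := hx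
    obtain ⟨s, hs⟩ := hy
    exact ⟨_, projSums_add hr hs⟩

lemma projNorm_nonneg (x : V ⊗[𝕜] W) : 0 ≤ projNorm 𝕜 x :=
  Real.sInf_nonneg fun _ h => projSums_nonneg h

lemma projNorm_le {x : V ⊗[𝕜] W} {r : ℝ} (h : r ∈ projSums 𝕜 x) : projNorm 𝕜 x ≤ r :=
  csInf_le (projSums_bddBelow x) h

lemma le_projNorm {x : V ⊗[𝕜] W} {b : ℝ} (h : ∀ r ∈ projSums 𝕜 x, b ≤ r) :
    b ≤ projNorm 𝕜 x :=
  le_csInf (projSums_nonempty x) h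

lemma projNorm_zero : projNorm 𝕜 (0 : V ⊗[𝕜] W) = 0 :=
  le_antisymm (projNorm_le ⟨0, 0, 0, by simp, by simp⟩) (projNorm_nonneg _)

lemma projNorm_add_le (x y : V ⊗[𝕜] W) :
    projNorm 𝕜 (x + y) ≤ projNorm 𝕜 x + projNorm 𝕜 y := by
  rw [← sub_le_iff_le_add]
  refine le_projNorm fun r hr => ?_
  rw [sub_le_iff_le_add', ← sub_le_iff_le_add]
  refine le_projNorm fun s hs => ?_
  rw [sub_le_iff_le_add]
  linarith [projNorm_le (projSums_add hr hs)]

lemma projNorm_smul_le (c : 𝕜) (x : V ⊗[𝕜] W) :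
    projNorm 𝕜 (c • x) ≤ ‖c‖ * projNorm 𝕜 x := by
  rcases eq_or_ne c 0 with rfl | hc
  · simp [projNorm_zero]
  · have hc' : 0 < ‖c‖ := norm_pos_iff.2 hc
    rw [← div_le_iff₀' hc']
    refine le_projNorm fun r hr => ?_
    rw [div_le_iff₀' hc']
    exact projNorm_le (projSums_smul c hr)

variable (𝕜 V W) in
/-- The projective seminorm. -/
def projSeminorm : Seminorm 𝕜 (V ⊗[𝕜] W) :=
  .ofSMulLE (projNorm 𝕜) projNorm_zero projNorm_add_le projNorm_smul_le

variable (𝕜 V W) in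
/-- The tensor product, as a seminormed group under the projective seminorm. -/
@[reducible] def projGroup : SeminormedAddCommGroup (V ⊗[𝕜] W) :=
  (projSeminorm 𝕜 V W).toAddGroupSeminorm.toSeminormedAddCommGroup

variable (𝕜 V W) in
/-- The tensor product, as a seminormed space under the projective seminorm. -/
@[reducible] def projSpace :
    @NormedSpace 𝕜 (V ⊗[𝕜] W) _ (projGroup 𝕜 V W) :=
  letI := projGroup 𝕜 V W
  { norm_smul_le := projNorm_smul_le }

lemma projNorm_tmul_le (v : V) (w : W) : projNorm 𝕜 (v ⊗ₜ[𝕜] w) ≤ ‖v‖ * ‖w‖ :=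
  projNorm_le (projSums_tmul v w)

/-- The universal property of the projective seminorm. -/
lemma norm_le_of_tmul (f : V ⊗[𝕜] W →ₗ[𝕜] Z) (C : ℝ) (hC : 0 ≤ C)
    (hf : ∀ v w, ‖f (v ⊗ₜ w)‖ ≤ C * (‖v‖ * ‖w‖)) (x : V ⊗[𝕜] W) :
    ‖f x‖ ≤ C * projNorm 𝕜 x := by
  have key : ∀ r ∈ projSums 𝕜 x, ‖f x‖ ≤ C * r := by
    rintro r ⟨n, v, w, rfl, rfl⟩
    rw [map_sum, Finset.mul_sum]
    exact (norm_sum_le _ _).trans (Finset.sum_le_sum fun i _ => hf _ _)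
  rcases hC.eq_or_lt with rfl | hC
  · obtain ⟨r, hr⟩ := projSums_nonempty x
    simpa using key r hr
  · rw [← div_le_iff₀' hC]
    refine le_projNorm fun r hr => ?_
    rw [div_le_iff₀' hC]
    exact key r hr

/-- The projective seminorm of normed spaces is a norm. -/
lemma eq_zero_of_projNorm_eq_zero (hV : ∀ v : V, ‖v‖ = 0 → v = 0)
    (hW : ∀ w : W, ‖w‖ = 0 → w = 0) (x : V ⊗[𝕜] W) (hx : projNorm 𝕜 x = 0) : x = 0 := by
  classical
  have sdV : SeparatingDual 𝕜 V := by
    let _ : NormedAddCommGroup V := NormedAddCommGroup.ofSeparation fun v => hV v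
    infer_instance
  have sdW : SeparatingDual 𝕜 W := by
    let _ : NormedAddCommGroup W := NormedAddCommGroup.ofSeparation fun w => hW w
    infer_instance
  let b := Module.Basis.ofVectorSpace 𝕜 V
  obtain ⟨t, rfl⟩ := (TensorProduct.equivFinsuppOfBasisLeft (N := W) b).symm.surjective x
  suffices t = 0 by simp [this]
  ext j
  by_contra hj
  have hjs : j ∈ t.support := Finsupp.mem_support_iff.2 hj
  obtain ⟨ψ, hψ⟩ := sdW.exists_ne_zero' _ hj
  have inj : Function.Injective (Fintype.linearCombination 𝕜 (fun i : t.support => b i)) :=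
    (b.linearIndependent.comp _ Subtype.val_injective).fintypeLinearCombination_injective
  obtain ⟨φ, hφ⟩ := SeparatingDual.dualMap_surjective_iff.2 inj
    (LinearMap.proj (⟨j, hjs⟩ : t.support))
  have hφ' : ∀ i : t.support, φ (b i) = if (i : _) = j then 1 else 0 := by
    intro i
    have := LinearMap.congr_fun hφ (Pi.single i 1)
    have e : Fintype.linearCombination 𝕜 (fun i : t.support => b i) (Pi.single i 1) = b i := by
      simp
    change φ _ = (Pi.single i 1 : t.support → 𝕜) _ at this
    rw [e, Pi.single_apply] at this
    rw [this]
    simp only [Subtype.ext_iff, eq_comm]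
  let F : V ⊗[𝕜] W →ₗ[𝕜] 𝕜 :=
    LinearMap.mul' 𝕜 𝕜 ∘ₗ TensorProduct.map φ.toLinearMap ψ.toLinearMap
  have hFb : ∀ v w, ‖F (v ⊗ₜ w)‖ ≤ ‖φ‖ * ‖ψ‖ * (‖v‖ * ‖w‖) := by
    intro v w
    have h1 := φ.le_opNorm v
    have h2 := ψ.le_opNorm w
    calc ‖F (v ⊗ₜ w)‖ = ‖φ v‖ * ‖ψ w‖ := by simp [F]
      _ ≤ (‖φ‖ * ‖v‖) * (‖ψ‖ * ‖w‖) := by gcongr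
      _ = _ := by ring
  have hF := norm_le_of_tmul F (‖φ‖ * ‖ψ‖) (by positivity) hFb
    ((TensorProduct.equivFinsuppOfBasisLeft b).symm t)
  rw [hx, mul_zero] at hF
  have hF0 := norm_le_zero_iff.1 hF
  rw [TensorProduct.equivFinsuppOfBasisLeft_symm_apply, Finsupp.sum, map_sum,
    Finset.sum_eq_single_of_mem j hjs] at hF0
  · have h1 := hφ' ⟨j, hjs⟩
    rw [if_pos rfl] at h1
    simp [F, h1] at hF0
    exact hψ hF0
  · intro i hi hij
    have h1 := hφ' ⟨i, hi⟩
    rw [if_neg hij] at h1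
    simp [F, h1]

end Projective

/-! ## The categories of seminormed and of normed spaces -/

/-- Which of the two categories is meant: seminormed spaces or normed spaces. -/
inductive Kind
  | seminormed
  | normed

/-- The objects of `SNorm₁` (for `κ = .seminormed`) and of its full subcategory `Norm₁`
(for `κ = .normed`): seminormed spaces over `𝕜`, whose seminorm is required to be a norm in the
second case. -/
structure NVec (𝕜 : Type u) [RCLike 𝕜] (κ : Kind) where
  carrier : Type u
  [grp : SeminormedAddCommGroup carrier]
  [mod : NormedSpace 𝕜 carrier]
  norm_separates : κ = .normed → ∀ x : carrier, ‖x‖ = 0 → x = 0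

namespace NVec

variable {𝕜 : Type u} [RCLike 𝕜] {κ : Kind}

instance : CoeSort (NVec 𝕜 κ) (Type u) := ⟨NVec.carrier⟩

attribute [instance] NVec.grp NVec.mod

/-- Nonexpansive linear maps. -/
@[ext]
structure Hom (X Y : NVec 𝕜 κ) where
  lin : X →ₗ[𝕜] Y
  norm_le : ∀ x, ‖lin x‖ ≤ ‖x‖

instance : Category (NVec 𝕜 κ) where
  Hom := Hom
  id X := ⟨LinearMap.id, fun _ => le_rfl⟩
  comp f g := ⟨g.lin ∘ₗ f.lin, fun x => (g.norm_le _).trans (f.norm_le x)⟩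

/-- The linear map underlying a morphism. -/
def toLin {X Y : NVec 𝕜 κ} (f : X ⟶ Y) : X →ₗ[𝕜] Y := Hom.lin f

lemma norm_toLin_le {X Y : NVec 𝕜 κ} (f : X ⟶ Y) (x : X) : ‖toLin f x‖ ≤ ‖x‖ := Hom.norm_le f x

/-- Bundle a nonexpansive linear map. -/
def mkHom {X Y : NVec 𝕜 κ} (f : X →ₗ[𝕜] Y) (hf : ∀ x, ‖f x‖ ≤ ‖x‖) : X ⟶ Y := Hom.mk f hf

@[simp] lemma toLin_mkHom {X Y : NVec 𝕜 κ} (f : X →ₗ[𝕜] Y) (hf : ∀ x, ‖f x‖ ≤ ‖x‖) :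
    toLin (mkHom f hf) = f := rfl

@[simp] lemma toLin_id (X : NVec 𝕜 κ) : toLin (𝟙 X) = LinearMap.id := rfl

@[simp] lemma toLin_comp {X Y Z : NVec 𝕜 κ} (f : X ⟶ Y) (g : Y ⟶ Z) :
    toLin (f ≫ g) = toLin g ∘ₗ toLin f := rfl

lemma hom_ext_lin {X Y : NVec 𝕜 κ} {f g : X ⟶ Y} (h : toLin f = toLin g) : f = g := Hom.ext h

lemma hom_ext {X Y : NVec 𝕜 κ} {f g : X ⟶ Y} (h : ∀ x, toLin f x = toLin g x) : f = g :=
  hom_ext_lin (LinearMap.ext h)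

/-- A morphism as a bounded linear map. -/
def toCLM {X Y : NVec 𝕜 κ} (f : X ⟶ Y) : X →L[𝕜] Y :=
  (toLin f).mkContinuous 1 fun x => by simpa using norm_toLin_le f x

@[simp] lemma toCLM_apply {X Y : NVec 𝕜 κ} (f : X ⟶ Y) (x : X) : toCLM f x = toLin f x := rfl

lemma norm_toCLM_le {X Y : NVec 𝕜 κ} (f : X ⟶ Y) : ‖toCLM f‖ ≤ 1 :=
  LinearMap.mkContinuous_norm_le _ zero_le_one _

/-- An isomorphism from a linear equivalence that is nonexpansive in both directions. -/
def mkIso {X Y : NVec 𝕜 κ} (e : X ≃ₗ[𝕜] Y) (h₁ : ∀ x, ‖e x‖ ≤ ‖x‖) (h₂ : ∀ y, ‖e.symm y‖ ≤ ‖y‖) :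
    X ≅ Y where
  hom := mkHom e.toLinearMap h₁
  inv := mkHom e.symm.toLinearMap h₂
  hom_inv_id := hom_ext fun x => e.symm_apply_apply x
  inv_hom_id := hom_ext fun x => e.apply_symm_apply x

/-! ### The monoidal structure -/

/-- The scalars `R = 𝕜`, as an object. -/
def scalars (𝕜 : Type u) [RCLike 𝕜] (κ : Kind) : NVec 𝕜 κ where
  carrier := 𝕜
  norm_separates _ _ := norm_eq_zero.1

/-- The algebraic tensor product with the projective seminorm. -/
def tensor (X Y : NVec 𝕜 κ) : NVec 𝕜 κ where
  carrier := X ⊗[𝕜] Y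
  grp := projGroup 𝕜 X Y
  mod := projSpace 𝕜 X Y
  norm_separates h := eq_zero_of_projNorm_eq_zero (X.norm_separates h) (Y.norm_separates h)

/-- The pure tensors. -/
def tmul {X Y : NVec 𝕜 κ} (x : X) (y : Y) : tensor X Y := x ⊗ₜ[𝕜] y

lemma norm_tmul_le {X Y : NVec 𝕜 κ} (x : X) (y : Y) : ‖tmul x y‖ ≤ ‖x‖ * ‖y‖ :=
  projNorm_tmul_le x y

lemma tensor_norm_le {X Y : NVec 𝕜 κ} {Z : Type*} [SeminormedAddCommGroup Z] [NormedSpace 𝕜 Z]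
    (f : tensor X Y →ₗ[𝕜] Z) {C : ℝ} (hC : 0 ≤ C)
    (hf : ∀ x y, ‖f (tmul x y)‖ ≤ C * (‖x‖ * ‖y‖)) (t : tensor X Y) : ‖f t‖ ≤ C * ‖t‖ :=
  norm_le_of_tmul f C hC hf t

lemma tensor_norm_le_one {X Y Z : NVec 𝕜 κ} (f : X ⊗[𝕜] Y →ₗ[𝕜] Z)
    (hf : ∀ (x : X) (y : Y), ‖f (x ⊗ₜ y)‖ ≤ ‖x‖ * ‖y‖) (t : tensor X Y) : ‖f t‖ ≤ ‖t‖ := by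
  have := tensor_norm_le (X := X) (Y := Y) f zero_le_one
    (fun x y => (hf x y).trans_eq (one_mul _).symm) t
  rwa [one_mul] at this

/-- The morphism out of a tensor product given by a linear map. -/
def tensorDesc {X Y Z : NVec 𝕜 κ} (f : X ⊗[𝕜] Y →ₗ[𝕜] Z)
    (hf : ∀ (x : X) (y : Y), ‖f (x ⊗ₜ y)‖ ≤ ‖x‖ * ‖y‖) : tensor X Y ⟶ Z :=
  mkHom (X := tensor X Y) f (tensor_norm_le_one f hf)

/-- The tensor product of morphisms. -/
def tensorMap {X₁ Y₁ X₂ Y₂ : NVec 𝕜 κ} (f : X₁ ⟶ Y₁) (g : X₂ ⟶ Y₂) :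
    tensor X₁ X₂ ⟶ tensor Y₁ Y₂ :=
  tensorDesc (Z := tensor Y₁ Y₂) (TensorProduct.map (toLin f) (toLin g)) fun x y =>
    (norm_tmul_le (toLin f x) (toLin g y)).trans
      (mul_le_mul (norm_toLin_le f x) (norm_toLin_le g y) (norm_nonneg _) (norm_nonneg _))

lemma norm_assoc_le (X Y Z : NVec 𝕜 κ) (t : tensor (tensor X Y) Z) :
    @norm (tensor X (tensor Y Z)) _ (TensorProduct.assoc 𝕜 X Y Z t) ≤ ‖t‖ := by
  refine tensor_norm_le_one (X := tensor X Y) (Z := tensor X (tensor Y Z))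
    (TensorProduct.assoc 𝕜 X Y Z).toLinearMap (fun s z => ?_) t
  have := tensor_norm_le (X := X) (Y := Y) (Z := tensor X (tensor Y Z))
    ((TensorProduct.assoc 𝕜 X Y Z).toLinearMap ∘ₗ (TensorProduct.mk 𝕜 (X ⊗[𝕜] Y) Z).flip z)
    (norm_nonneg z) (fun x y => ?_) s
  · exact this.trans_eq (mul_comm _ _)
  · refine (norm_tmul_le x (tmul y z)).trans ?_
    calc ‖x‖ * ‖tmul y z‖
      _ ≤ ‖x‖ * (‖y‖ * ‖z‖) := by gcongr; exact norm_tmul_le y z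
      _ = _ := by ring

lemma norm_assoc_symm_le (X Y Z : NVec 𝕜 κ) (t : tensor X (tensor Y Z)) :
    @norm (tensor (tensor X Y) Z) _ ((TensorProduct.assoc 𝕜 X Y Z).symm t) ≤ ‖t‖ := by
  refine tensor_norm_le_one (Y := tensor Y Z) (Z := tensor (tensor X Y) Z)
    (TensorProduct.assoc 𝕜 X Y Z).symm.toLinearMap (fun x s => ?_) t
  have := tensor_norm_le (X := Y) (Y := Z) (Z := tensor (tensor X Y) Z)
    ((TensorProduct.assoc 𝕜 X Y Z).symm.toLinearMap ∘ₗ TensorProduct.mk 𝕜 X (Y ⊗[𝕜] Z) x)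
    (norm_nonneg x) (fun y z => ?_) s
  · exact this
  · refine (norm_tmul_le (tmul x y) z).trans ?_
    calc ‖tmul x y‖ * ‖z‖
      _ ≤ (‖x‖ * ‖y‖) * ‖z‖ := by gcongr; exact norm_tmul_le x y
      _ = _ := by ring

/-- The associativity isomorphism. -/
def assocIso (X Y Z : NVec 𝕜 κ) : tensor (tensor X Y) Z ≅ tensor X (tensor Y Z) :=
  mkIso (X := tensor (tensor X Y) Z) (Y := tensor X (tensor Y Z)) (TensorProduct.assoc 𝕜 X Y Z)
    (norm_assoc_le X Y Z) (norm_assoc_symm_le X Y Z)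

/-- The left unit isomorphism. -/
def leftUnitIso (X : NVec 𝕜 κ) : tensor (scalars 𝕜 κ) X ≅ X :=
  mkIso (X := tensor (scalars 𝕜 κ) X) (TensorProduct.lid 𝕜 X)
    (tensor_norm_le_one (X := scalars 𝕜 κ) (Y := X) (TensorProduct.lid 𝕜 X).toLinearMap
      fun c x => (norm_smul (α := 𝕜) c x).le)
    (fun x => (norm_tmul_le (X := scalars 𝕜 κ) (1 : 𝕜) x).trans_eq
      ((congrArg (· * ‖x‖) (norm_one (α := 𝕜))).trans (one_mul _)))

/-- The right unit isomorphism. -/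
def rightUnitIso (X : NVec 𝕜 κ) : tensor X (scalars 𝕜 κ) ≅ X :=
  mkIso (X := tensor X (scalars 𝕜 κ)) (TensorProduct.rid 𝕜 X)
    (tensor_norm_le_one (Y := scalars 𝕜 κ) (TensorProduct.rid 𝕜 X).toLinearMap
      fun x c => (norm_smul (α := 𝕜) c x).le.trans_eq (mul_comm _ _))
    (fun x => (norm_tmul_le (Y := scalars 𝕜 κ) x (1 : 𝕜)).trans_eq
      ((congrArg (‖x‖ * ·) (norm_one (α := 𝕜))).trans (mul_one _)))

/-- The symmetry isomorphism. -/
def braidIso (X Y : NVec 𝕜 κ) : tensor X Y ≅ tensor Y X :=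
  mkIso (X := tensor X Y) (Y := tensor Y X) (TensorProduct.comm 𝕜 X Y)
    (tensor_norm_le_one (Z := tensor Y X) (TensorProduct.comm 𝕜 X Y).toLinearMap
      fun x y => (norm_tmul_le y x).trans_eq (mul_comm _ _))
    (tensor_norm_le_one (Z := tensor X Y) (TensorProduct.comm 𝕜 X Y).symm.toLinearMap
      fun y x => (norm_tmul_le x y).trans_eq (mul_comm _ _))

instance : MonoidalCategoryStruct (NVec 𝕜 κ) where
  tensorObj := tensor
  whiskerLeft X _ _ f := tensorMap (𝟙 X) f
  whiskerRight f X := tensorMap f (𝟙 X)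
  tensorHom := tensorMap
  tensorUnit := scalars 𝕜 κ
  associator := assocIso
  leftUnitor := leftUnitIso
  rightUnitor := rightUnitIso

lemma tensor_hom_ext {X Y Z : NVec 𝕜 κ} {f g : X ⊗ Y ⟶ Z}
    (h : ∀ (x : X) (y : Y), toLin f (tmul x y) = toLin g (tmul x y)) : f = g :=
  hom_ext_lin (TensorProduct.ext' (R := 𝕜) (M := X) (N := Y) h)

lemma tensor_hom_ext₃ {X Y Z W : NVec 𝕜 κ} {f g : (X ⊗ Y) ⊗ Z ⟶ W}
    (h : ∀ (x : X) (y : Y) (z : Z),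
      toLin f (tmul (X := X ⊗ Y) (tmul x y) z) = toLin g (tmul (X := X ⊗ Y) (tmul x y) z)) :
    f = g :=
  hom_ext_lin (TensorProduct.ext_threefold (R := 𝕜) (M := X) (N := Y) (P := Z) h)

instance : MonoidalCategory (NVec 𝕜 κ) where
  tensorHom_def _ _ := tensor_hom_ext fun _ _ => rfl
  id_tensorHom_id _ _ := tensor_hom_ext fun _ _ => rfl
  tensorHom_comp_tensorHom _ _ _ _ := tensor_hom_ext fun _ _ => rfl
  whiskerLeft_id _ _ := tensor_hom_ext fun _ _ => rfl
  id_whiskerRight _ _ := tensor_hom_ext fun _ _ => rfl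
  associator_naturality _ _ _ := tensor_hom_ext₃ fun _ _ _ => rfl
  leftUnitor_naturality f := tensor_hom_ext fun c x => ((toLin f).map_smul c x).symm
  rightUnitor_naturality f := tensor_hom_ext fun x c => ((toLin f).map_smul c x).symm
  pentagon W X Y Z := hom_ext_lin
    (TensorProduct.ext_fourfold (R := 𝕜) (M := W) (N := X) (P := Y) (Q := Z) fun _ _ _ _ => rfl)
  triangle _ _ := tensor_hom_ext₃ (Y := 𝟙_ _) fun x c y =>
    (TensorProduct.smul_tmul (R := 𝕜) (R' := 𝕜) c x y).symm

instance : SymmetricCategory (NVec 𝕜 κ) where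
  braiding := braidIso
  braiding_naturality_right _ _ _ _ := tensor_hom_ext fun _ _ => rfl
  braiding_naturality_left _ _ := tensor_hom_ext fun _ _ => rfl
  hexagon_forward _ _ _ := tensor_hom_ext₃ fun _ _ _ => rfl
  hexagon_reverse X Y Z := hom_ext_lin
    (TensorProduct.ext_threefold' (R := 𝕜) (M := X) (N := Y) (P := Z) fun _ _ _ => rfl)
  symmetry _ _ := tensor_hom_ext fun _ _ => rfl

/-! ### The internal hom -/

/-- The internal hom: all bounded linear maps, with the operator seminorm. -/
def homObj (X Y : NVec 𝕜 κ) : NVec 𝕜 κ where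
  carrier := X →L[𝕜] Y
  norm_separates h f hf := by
    ext x
    refine Y.norm_separates h _ (le_antisymm ?_ (norm_nonneg _))
    simpa [hf] using f.le_opNorm x

/-- The bounded linear map `f (- ⊗ z)`. -/
def curryVal {X Y Z : NVec 𝕜 κ} (f : X ⊗ Z ⟶ Y) (z : Z) : X →L[𝕜] Y :=
  LinearMap.mkContinuous ((toLin f : X ⊗[𝕜] Z →ₗ[𝕜] Y) ∘ₗ (TensorProduct.mk 𝕜 X Z).flip z) ‖z‖
    fun x => ((norm_toLin_le f (tmul x z)).trans (norm_tmul_le x z)).trans_eq (mul_comm _ _)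

lemma norm_curryVal_le {X Y Z : NVec 𝕜 κ} (f : X ⊗ Z ⟶ Y) (z : Z) : ‖curryVal f z‖ ≤ ‖z‖ :=
  LinearMap.mkContinuous_norm_le _ (norm_nonneg z) _

/-- Currying. -/
def curryHom {X Y Z : NVec 𝕜 κ} (f : X ⊗ Z ⟶ Y) : Z ⟶ homObj X Y :=
  mkHom (Y := homObj X Y)
    { toFun := curryVal f
      map_add' := fun z w => ContinuousLinearMap.ext fun x =>
        (congrArg (toLin f) (TensorProduct.tmul_add (R := 𝕜) x z w)).trans
          (map_add (toLin f) (tmul x z) (tmul x w))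
      map_smul' := fun c z => ContinuousLinearMap.ext fun x =>
        (congrArg (toLin f) (TensorProduct.tmul_smul (R := 𝕜) c x z)).trans
          (map_smul (toLin f) c (tmul x z)) }
    (norm_curryVal_le f)

/-- Uncurrying. -/
def uncurryHom {X Y Z : NVec 𝕜 κ} (g : Z ⟶ homObj X Y) : X ⊗ Z ⟶ Y :=
  tensorDesc (TensorProduct.lift
    (LinearMap.flip (ContinuousLinearMap.coeLM 𝕜 ∘ₗ (toLin g : Z →ₗ[𝕜] (X →L[𝕜] Y)))))
    fun x z => (ContinuousLinearMap.le_opNorm (toLin g z : X →L[𝕜] Y) x).trans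
      ((mul_le_mul_of_nonneg_right (norm_toLin_le g z) (norm_nonneg x)).trans_eq (mul_comm _ _))

/-- The functor `homObj X`. -/
def homFunctor (X : NVec 𝕜 κ) : NVec 𝕜 κ ⥤ NVec 𝕜 κ where
  obj := homObj X
  map g := mkHom (X := homObj X _) (Y := homObj X _)
    { toFun := fun φ : X →L[𝕜] _ => (toCLM g).comp φ
      map_add' := fun _ _ => ContinuousLinearMap.ext fun x => map_add (toLin g) _ _
      map_smul' := fun _ _ => ContinuousLinearMap.ext fun x => map_smul (toLin g) _ _ }
    fun φ => ((toCLM g).opNorm_comp_le φ).trans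
      ((mul_le_mul_of_nonneg_right (norm_toCLM_le g) (norm_nonneg _)).trans_eq (one_mul _))

/-- The tensor-hom adjunction. -/
def tensorHomAdj (X : NVec 𝕜 κ) : tensorLeft X ⊣ homFunctor X :=
  Adjunction.mkOfHomEquiv
    { homEquiv := fun _ _ =>
        { toFun := curryHom
          invFun := uncurryHom
          left_inv := fun _ => tensor_hom_ext fun _ _ => rfl
          right_inv := fun _ => hom_ext fun _ => ContinuousLinearMap.ext fun _ => rfl }
      homEquiv_naturality_left_symm := fun _ _ => tensor_hom_ext fun _ _ => rfl
      homEquiv_naturality_right := fun _ _ => hom_ext fun _ =>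
        ContinuousLinearMap.ext fun _ => rfl }

instance : MonoidalClosed (NVec 𝕜 κ) where
  closed X := { rightAdj := homFunctor X, adj := tensorHomAdj X }

/-- Elements of the internal hom as bounded linear maps. -/
def homVal {X Y : NVec 𝕜 κ} (f : (ihom X).obj Y) : X →L[𝕜] Y := f

lemma eComp_tmul {X Y Z : NVec 𝕜 κ} (f : X →L[𝕜] Y) (g : Y →L[𝕜] Z) :
    toLin (eComp (NVec 𝕜 κ) X Y Z) (tmul (X := homObj X Y) (Y := homObj Y Z) f g) =
      (g.comp f : X →L[𝕜] Z) := rfl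

lemma eHomEquiv_apply {X Y : NVec 𝕜 κ} (f : X ⟶ Y) (c : 𝕜) :
    (toLin (eHomEquiv (NVec 𝕜 κ) f) c : X →L[𝕜] Y) = c • toCLM f :=
  ContinuousLinearMap.ext fun x => map_smul (toLin f) c x

lemma eId_apply (X : NVec 𝕜 κ) (c : 𝕜) :
    (toLin (eId (NVec 𝕜 κ) X) c : X →L[𝕜] X) = c • ContinuousLinearMap.id 𝕜 X := rfl

lemma eHomWhiskerRight_apply {X X' : NVec 𝕜 κ} (f : X ⟶ X') (Y : NVec 𝕜 κ) (φ : X' →L[𝕜] Y) :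
    toLin (eHomWhiskerRight (NVec 𝕜 κ) f Y) φ = (φ.comp (toCLM f) : X →L[𝕜] Y) := by
  rw [MonoidalClosed.enrichedOrdinaryCategorySelf_eHomWhiskerRight]
  rfl

lemma eHomWhiskerLeft_apply (X : NVec 𝕜 κ) {Y Y' : NVec 𝕜 κ} (g : Y ⟶ Y') (φ : X →L[𝕜] Y) :
    toLin (eHomWhiskerLeft (NVec 𝕜 κ) X g) φ = ((toCLM g).comp φ : X →L[𝕜] Y') := by
  rw [MonoidalClosed.enrichedOrdinaryCategorySelf_eHomWhiskerLeft]
  rfl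

lemma eHomWhiskerLeft_op_apply (X : (NVec 𝕜 κ)ᵒᵖ) {Y Y' : (NVec 𝕜 κ)ᵒᵖ} (g : Y ⟶ Y')
    (φ : Y.unop →L[𝕜] X.unop) :
    toLin (eHomWhiskerLeft (NVec 𝕜 κ) X g) φ = (φ.comp (toCLM g.unop) : Y'.unop →L[𝕜] X.unop) :=
  ContinuousLinearMap.ext fun y => congrArg φ <|
    ((toLin g.unop).map_smul (1 : 𝕜) y).trans (one_smul 𝕜 _)

lemma eHomWhiskerRight_op_apply {X X' : (NVec 𝕜 κ)ᵒᵖ} (f : X ⟶ X') (Y : (NVec 𝕜 κ)ᵒᵖ)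
    (φ : Y.unop →L[𝕜] X'.unop) :
    toLin (eHomWhiskerRight (NVec 𝕜 κ) f Y) φ = ((toCLM f.unop).comp φ : Y.unop →L[𝕜] X.unop) :=
  ContinuousLinearMap.ext fun y =>
    ((toLin f.unop).map_smul (1 : 𝕜) (φ y)).trans (one_smul 𝕜 _)

/-! ### Double dualization -/

/-- The dual `X* = V(X, R)`. -/
abbrev dualObj (X : NVec 𝕜 κ) : NVec 𝕜 κ := (ihom X).obj (scalars 𝕜 κ)

/-- The morphism `V(X, Y) ⟶ V(Y*, X*)` sending `f` to `f* : ψ ↦ ψ ∘ f`. -/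
def transpose (X Y : NVec 𝕜 κ) : (ihom X).obj Y ⟶ (ihom (dualObj Y)).obj (dualObj X) :=
  mkHom (X := homObj X Y) (Y := homObj (homObj Y (scalars 𝕜 κ)) (homObj X (scalars 𝕜 κ)))
    (ContinuousLinearMap.compL 𝕜 X Y 𝕜).flip.toLinearMap fun f =>
      ((ContinuousLinearMap.compL 𝕜 X Y 𝕜).flip.le_opNorm f).trans
        ((mul_le_mul_of_nonneg_right
          ((ContinuousLinearMap.opNorm_flip _).trans_le (ContinuousLinearMap.norm_compL_le 𝕜 X Y 𝕜))
          (norm_nonneg f)).trans_eq (one_mul _))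

variable (𝕜 κ) in
/-- Dualization, as a `V`-functor to the opposite `V`-category. -/
def dualOp : EnrichedFunctor (NVec 𝕜 κ) (NVec 𝕜 κ) (NVec 𝕜 κ)ᵒᵖ where
  obj X := .op (dualObj X)
  map X Y := transpose X Y
  map_id X := hom_ext fun c => ContinuousLinearMap.ext fun φ => ContinuousLinearMap.ext fun x =>
    (φ : X →L[𝕜] 𝕜).map_smul c x
  map_comp _ _ _ := tensor_hom_ext fun _ _ => rfl

variable (𝕜 κ) in
/-- Dualization, as a `V`-functor from the opposite `V`-category. -/
def dual : EnrichedFunctor (NVec 𝕜 κ) (NVec 𝕜 κ)ᵒᵖ (NVec 𝕜 κ) where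
  obj X := dualObj X.unop
  map X Y := transpose Y.unop X.unop
  map_id X := hom_ext fun c => ContinuousLinearMap.ext fun φ => ContinuousLinearMap.ext fun x =>
    (φ : X.unop →L[𝕜] 𝕜).map_smul c x
  map_comp _ _ _ := tensor_hom_ext fun _ _ => rfl

/-- The canonical morphism `X ⟶ X**`, sending `x` to evaluation at `x`. -/
def toDoubleDual (X : NVec 𝕜 κ) : X ⟶ dualObj (dualObj X) :=
  mkHom (Y := homObj (homObj X (scalars 𝕜 κ)) (scalars 𝕜 κ))
    (NormedSpace.inclusionInDoubleDual 𝕜 X).toLinearMap (NormedSpace.double_dual_bound 𝕜 X)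

lemma toLin_toDoubleDual (X : NVec 𝕜 κ) (x : X) (φ : X →L[𝕜] 𝕜) :
    homVal (toLin (toDoubleDual X) x) φ = φ x := rfl

/-- The dual `f* : Y* ⟶ X*` of a morphism `f`. -/
def dualHom {X Y : NVec 𝕜 κ} (f : X ⟶ Y) : dualObj Y ⟶ dualObj X :=
  mkHom (X := homObj Y (scalars 𝕜 κ)) (Y := homObj X (scalars 𝕜 κ))
    ((ContinuousLinearMap.compL 𝕜 X Y 𝕜).flip (toCLM f)).toLinearMap fun ψ =>
      (ψ.opNorm_comp_le (toCLM f)).trans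
        ((mul_le_mul_of_nonneg_left (norm_toCLM_le f) (norm_nonneg ψ)).trans_eq (mul_one _))

lemma dualHom_apply {X Y : NVec 𝕜 κ} (f : X ⟶ Y) (ψ : Y →L[𝕜] 𝕜) :
    toLin (dualHom f) ψ = (ψ.comp (toCLM f) : X →L[𝕜] 𝕜) := rfl

lemma underMap_dual {X Y : NVec 𝕜 κ} (f : X ⟶ Y) : underMap (dual 𝕜 κ) f.op = dualHom f := by
  refine (Equiv.symm_apply_eq _).2 (hom_ext fun c => ContinuousLinearMap.ext fun ψ =>
    ContinuousLinearMap.ext fun x => ?_)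
  exact (congrArg (fun y => homVal ψ y) ((toLin f).map_smul c x)).trans
    ((homVal ψ).map_smul c (toLin f x))

lemma underMap_dualOp {X Y : NVec 𝕜 κ} (f : X ⟶ Y) :
    underMap (dualOp 𝕜 κ) f = (dualHom f).op := by
  refine (Equiv.symm_apply_eq _).2 (hom_ext fun c => ContinuousLinearMap.ext fun ψ =>
    ContinuousLinearMap.ext fun x => ?_)
  exact (congrArg (fun y => homVal ψ y) ((toLin f).map_smul c x)).trans
    ((homVal ψ).map_smul c (toLin f x))

lemma toDoubleDual_natural (X Y : NVec 𝕜 κ) :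
    eHomWhiskerLeft (NVec 𝕜 κ) X (toDoubleDual Y) =
      transpose X Y ≫ transpose (dualObj Y) (dualObj X) ≫
        eHomWhiskerRight (NVec 𝕜 κ) (toDoubleDual X) (dualObj (dualObj Y)) := by
  rw [MonoidalClosed.enrichedOrdinaryCategorySelf_eHomWhiskerLeft,
    MonoidalClosed.enrichedOrdinaryCategorySelf_eHomWhiskerRight]
  exact hom_ext fun f => rfl

lemma eHomWhiskerLeft_op (X : (NVec 𝕜 κ)ᵒᵖ) {Y Y' : (NVec 𝕜 κ)ᵒᵖ} (g : Y ⟶ Y') :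
    eHomWhiskerLeft (NVec 𝕜 κ) X g = eHomWhiskerRight (NVec 𝕜 κ) g.unop X.unop :=
  hom_ext fun φ => (eHomWhiskerLeft_op_apply X g φ).trans
    (eHomWhiskerRight_apply g.unop X.unop φ).symm

lemma eHomWhiskerRight_op {X X' : (NVec 𝕜 κ)ᵒᵖ} (f : X ⟶ X') (Y : (NVec 𝕜 κ)ᵒᵖ) :
    eHomWhiskerRight (NVec 𝕜 κ) f Y = eHomWhiskerLeft (NVec 𝕜 κ) Y.unop f.unop :=
  hom_ext fun φ => (eHomWhiskerRight_op_apply f Y φ).trans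
    (eHomWhiskerLeft_apply Y.unop f.unop φ).symm

lemma toDoubleDual_triangle (X : NVec 𝕜 κ) :
    toDoubleDual (dualObj X) ≫ dualHom (toDoubleDual X) = 𝟙 (dualObj X) := rfl

variable (𝕜 κ) in
/-- The dualization `V`-adjunction. -/
def dualAdjunction : VAdjunction (dualOp 𝕜 κ) (dual 𝕜 κ) where
  unit := toDoubleDual
  counit Y := (toDoubleDual Y.unop).op
  unit_natural X Y := (Category.id_comp _).trans
    ((toDoubleDual_natural X Y).trans (Category.assoc _ _ _).symm)
  counit_natural X Y := by
    refine Eq.trans ?_ (Category.id_comp _).symm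
    refine Eq.trans ?_ (eHomWhiskerRight_op (toDoubleDual X.unop).op Y).symm
    refine Eq.trans ?_ (toDoubleDual_natural Y.unop X.unop).symm
    refine (Category.assoc _ _ _).trans ?_
    exact congrArg (fun t => transpose Y.unop X.unop ≫
      transpose (dualObj X.unop) (dualObj Y.unop) ≫ t)
      (eHomWhiskerLeft_op (.op (dualObj (dualObj X.unop))) (toDoubleDual Y.unop).op)
  left_triangle X := (congrArg (· ≫ (toDoubleDual (dualObj X)).op)
    (underMap_dualOp (toDoubleDual X))).trans (congrArg Quiver.Hom.op (toDoubleDual_triangle X))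
  right_triangle Y := (congrArg (toDoubleDual (dualObj Y.unop) ≫ ·)
    (underMap_dual (toDoubleDual Y.unop))).trans (toDoubleDual_triangle Y.unop)

variable (𝕜 κ) in
/-- The double-dualization `V`-monad. -/
def doubleDualMonad : VMonad (NVec 𝕜 κ) (NVec 𝕜 κ) := (dualAdjunction 𝕜 κ).toVMonad

/-! ### Completion -/

/-- Banach spaces, as objects of `SNorm₁` or `Norm₁`: the complete spaces whose seminorm is a
norm. -/
def IsBanach : ObjectProperty (NVec 𝕜 κ) := fun X =>
  CompleteSpace X ∧ ∀ x : X, ‖x‖ = 0 → x = 0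

lemma IsBanach.t0Space {X : NVec 𝕜 κ} (h : IsBanach X) : T0Space X :=
  (NormedAddCommGroup.ofSeparation fun x => h.2 x).toMetricSpace.instT0Space

/-- The Cauchy completion. -/
def compl (X : NVec 𝕜 κ) : NVec 𝕜 κ where
  carrier := UniformSpace.Completion X
  norm_separates _ x := norm_eq_zero (E := UniformSpace.Completion X) (a := x).1

lemma isBanach_compl (X : NVec 𝕜 κ) : IsBanach (compl X) :=
  ⟨inferInstanceAs (CompleteSpace (UniformSpace.Completion X)), fun x => norm_eq_zero (E := UniformSpace.Completion X) (a := x).1⟩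

/-- The canonical morphism `X ⟶ X̃`. -/
def toCompl (X : NVec 𝕜 κ) : X ⟶ compl X :=
  mkHom (Y := compl X) (UniformSpace.Completion.toComplₗᵢ (𝕜 := 𝕜)).toLinearMap fun x =>
    (UniformSpace.Completion.norm_coe x).le

lemma denseRange_toCompl (X : NVec 𝕜 κ) : DenseRange (toLin (toCompl X)) :=
  UniformSpace.Completion.denseRange_coe

/-- Bounded linear maps on a completion are determined by their values on the given space. -/
lemma complExt {X Z : NVec 𝕜 κ} (hZ : IsBanach Z) {f g : compl X →L[𝕜] Z}
    (h : ∀ x : X, f (toLin (toCompl X) x) = g (toLin (toCompl X) x)) : f = g := by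
  have := hZ.t0Space
  exact ContinuousLinearMap.coeFn_injective
    ((denseRange_toCompl X).equalizer f.continuous g.continuous (funext h))

/-- The extension of a bounded linear map to the completion. -/
def extendCompl {X Z : NVec 𝕜 κ} (hZ : IsBanach Z) (f : X →L[𝕜] Z) : compl X →L[𝕜] Z :=
  haveI := hZ.1
  haveI := hZ.t0Space
  f.fromCompletion

lemma extendCompl_toCompl {X Z : NVec 𝕜 κ} (hZ : IsBanach Z) (f : X →L[𝕜] Z) (x : X) :
    extendCompl hZ f (toLin (toCompl X) x) = f x :=
  haveI := hZ.1
  haveI := hZ.t0Space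
  f.fromCompletion_apply_coe x

lemma norm_extendCompl_le {X Z : NVec 𝕜 κ} (hZ : IsBanach Z) (f : X →L[𝕜] Z) :
    ‖extendCompl hZ f‖ ≤ ‖f‖ := by
  refine ContinuousLinearMap.opNorm_le_bound _ (norm_nonneg f) fun x => ?_
  induction x using (denseRange_toCompl X).induction_on with
  | hp =>
    exact isClosed_le (extendCompl hZ f).continuous.norm (continuous_const.mul continuous_norm)
  | ih x =>
    rw [extendCompl_toCompl]
    exact (f.le_opNorm x).trans_eq
      (congrArg (‖f‖ * ·) (UniformSpace.Completion.norm_coe x).symm)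

/-- The morphism `V(X, Z) ⟶ V(X̃, Z)` extending bounded linear maps into a Banach space. -/
def extendHom (X : NVec 𝕜 κ) {Z : NVec 𝕜 κ} (hZ : IsBanach Z) :
    (ihom X).obj Z ⟶ (ihom (compl X)).obj Z :=
  mkHom (X := homObj X Z) (Y := homObj (compl X) Z)
    { toFun := extendCompl hZ
      map_add' := fun f g => complExt hZ fun x =>
        (extendCompl_toCompl hZ _ x).trans (congrArg₂ (· + ·)
          (extendCompl_toCompl hZ f x).symm (extendCompl_toCompl hZ g x).symm)
      map_smul' := fun c f => complExt hZ fun x =>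
        (extendCompl_toCompl hZ _ x).trans (congrArg (c • ·) (extendCompl_toCompl hZ f x).symm) }
    (norm_extendCompl_le hZ)

/-- The morphism `V(X, Y) ⟶ V(X̃, Ỹ)` sending `f` to its unique bounded extension `f̃`. -/
def complMap (X Y : NVec 𝕜 κ) : (ihom X).obj Y ⟶ (ihom (compl X)).obj (compl Y) :=
  (ihom X).map (toCompl Y) ≫ extendHom X (isBanach_compl Y)

lemma complMap_toCompl {X Y : NVec 𝕜 κ} (f : X →L[𝕜] Y) (x : X) :
    homVal (toLin (complMap X Y) f) (toLin (toCompl X) x) = toLin (toCompl Y) (f x) :=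
  extendCompl_toCompl (isBanach_compl Y) ((toCLM (toCompl Y)).comp f) x

lemma eId_complMap (X : NVec 𝕜 κ) :
    eId (NVec 𝕜 κ) X ≫ complMap X X = eId (NVec 𝕜 κ) (compl X) :=
  hom_ext fun c => complExt (isBanach_compl X) fun x =>
    (complMap_toCompl (homVal (toLin (eId (NVec 𝕜 κ) X) c)) x).trans
      ((toLin (toCompl X)).map_smul (show 𝕜 from c) x)

lemma eComp_complMap (X Y Z : NVec 𝕜 κ) :
    eComp (NVec 𝕜 κ) X Y Z ≫ complMap X Z =
      (complMap X Y ⊗ₘ complMap Y Z) ≫ eComp (NVec 𝕜 κ) (compl X) (compl Y) (compl Z) :=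
  tensor_hom_ext fun f g => complExt (isBanach_compl Z) fun x => by
    refine (complMap_toCompl ((homVal g).comp (homVal f)) x).trans ?_
    refine Eq.trans ?_ (congrArg (fun t => homVal (toLin (complMap Y Z) g) t)
      (complMap_toCompl (homVal f) x).symm)
    exact (complMap_toCompl (homVal g) (homVal f x)).symm

/-- The extension of a morphism to the completion. -/
def extendMor {X Z : NVec 𝕜 κ} (hZ : IsBanach Z) (f : X ⟶ Z) : compl X ⟶ Z :=
  mkHom (extendCompl hZ (toCLM f)).toLinearMap fun x =>
    ((extendCompl hZ (toCLM f)).le_opNorm x).trans ((mul_le_mul_of_nonneg_right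
      ((norm_extendCompl_le hZ _).trans (norm_toCLM_le f)) (norm_nonneg x)).trans_eq (one_mul _))

lemma toCLM_extendMor {X Z : NVec 𝕜 κ} (hZ : IsBanach Z) (f : X ⟶ Z) :
    toCLM (extendMor hZ f) = extendCompl hZ (toCLM f) := rfl

variable (𝕜 κ) in
/-- The category `Ban₁` of Banach spaces, as a full sub-`V`-category. -/
abbrev Ban₁ := (IsBanach (𝕜 := 𝕜) (κ := κ)).FullSubcategory

variable (𝕜 κ) in
/-- Completion, as a `V`-functor to Banach spaces. -/
def complFunctor : EnrichedFunctor (NVec 𝕜 κ) (NVec 𝕜 κ) (Ban₁ 𝕜 κ) where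
  obj X := ⟨compl X, isBanach_compl X⟩
  map X Y := complMap X Y
  map_id X := eId_complMap X
  map_comp X Y Z := eComp_complMap X Y Z

lemma extendMor_toCompl {X Z : NVec 𝕜 κ} (hZ : IsBanach Z) (f : X ⟶ Z) :
    toCompl X ≫ extendMor hZ f = f := hom_ext fun x => extendCompl_toCompl hZ (toCLM f) x

lemma compl_hom_ext {X Z : NVec 𝕜 κ} (hZ : IsBanach Z) {f g : compl X ⟶ Z}
    (h : toCompl X ≫ f = toCompl X ≫ g) : f = g := by
  have : toCLM f = toCLM g := complExt hZ fun x => congrArg (fun t => toLin t x) h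
  exact hom_ext fun x => congrArg (fun t : compl X →L[𝕜] Z => t x) this

lemma toCompl_natural (X Y : NVec 𝕜 κ) :
    eHomWhiskerLeft (NVec 𝕜 κ) X (toCompl Y) =
      complMap X Y ≫ eHomWhiskerRight (NVec 𝕜 κ) (toCompl X) (compl Y) := by
  rw [MonoidalClosed.enrichedOrdinaryCategorySelf_eHomWhiskerLeft,
    MonoidalClosed.enrichedOrdinaryCategorySelf_eHomWhiskerRight]
  exact hom_ext fun f => ContinuousLinearMap.ext fun x => (complMap_toCompl (homVal f) x).symm

lemma extendMor_natural {X Y : NVec 𝕜 κ} (hX : IsBanach X) (hY : IsBanach Y) :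
    complMap X Y ≫ eHomWhiskerLeft (NVec 𝕜 κ) (compl X) (extendMor hY (𝟙 Y)) =
      eHomWhiskerRight (NVec 𝕜 κ) (extendMor hX (𝟙 X)) Y := by
  rw [MonoidalClosed.enrichedOrdinaryCategorySelf_eHomWhiskerLeft,
    MonoidalClosed.enrichedOrdinaryCategorySelf_eHomWhiskerRight]
  refine hom_ext fun f => complExt hY fun x => ?_
  refine (congrArg (fun t => toLin (extendMor hY (𝟙 Y)) t) (complMap_toCompl (homVal f) x)).trans ?_
  refine (extendCompl_toCompl hY _ (homVal f x)).trans ?_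
  exact congrArg (fun t => homVal f t) (extendCompl_toCompl hX (toCLM (𝟙 X)) x).symm

lemma eHomEquiv_complMap {X Y : NVec 𝕜 κ} (f : X ⟶ Y) :
    eHomEquiv (NVec 𝕜 κ) f ≫ complMap X Y =
      eHomEquiv (NVec 𝕜 κ) (extendMor (isBanach_compl Y) (f ≫ toCompl Y)) :=
  hom_ext fun c => complExt (isBanach_compl Y) fun x => by
    refine (complMap_toCompl (homVal (toLin (eHomEquiv (NVec 𝕜 κ) f) c)) x).trans ?_
    refine (extendCompl_toCompl (isBanach_compl Y) (toCLM (f ≫ toCompl Y))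
      ((show 𝕜 from c) • x)).symm.trans ?_
    exact congrArg (fun t => extendCompl (isBanach_compl Y) (toCLM (f ≫ toCompl Y)) t)
      ((toLin (toCompl X)).map_smul (show 𝕜 from c) x)

lemma underMap_complFunctor {X Y : NVec 𝕜 κ} (f : X ⟶ Y) :
    underMap (complFunctor 𝕜 κ) f =
      ObjectProperty.homMk (extendMor (isBanach_compl Y) (f ≫ toCompl Y)) :=
  (Equiv.symm_apply_eq _).2 (eHomEquiv_complMap f)

lemma underMap_inclusion {X Y : Ban₁ 𝕜 κ} (f : X ⟶ Y) :
    underMap (inclusion (NVec 𝕜 κ) (IsBanach (𝕜 := 𝕜) (κ := κ))) f = f.hom :=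
  (Equiv.symm_apply_eq _).2 (Category.comp_id _)

variable (𝕜 κ) in
/-- The completion `V`-adjunction. -/
def complAdjunction :
    VAdjunction (complFunctor 𝕜 κ) (inclusion (NVec 𝕜 κ) (IsBanach (𝕜 := 𝕜) (κ := κ))) where
  unit := toCompl
  counit Y := ObjectProperty.homMk (extendMor Y.property (𝟙 Y.obj))
  unit_natural X Y := by
    refine (Category.id_comp _).trans ((toCompl_natural X Y).trans ?_)
    exact congrArg (· ≫ eHomWhiskerRight (NVec 𝕜 κ) (toCompl X) (compl Y))
      (Category.comp_id (complMap X Y)).symm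
  counit_natural X Y := by
    refine Eq.trans ?_ (Category.id_comp _).symm
    refine Eq.trans ?_ (extendMor_natural X.property Y.property)
    exact congrArg (· ≫ eHomWhiskerLeft (NVec 𝕜 κ) (compl X.obj) (extendMor Y.property (𝟙 Y.obj)))
      (Category.id_comp (complMap X.obj Y.obj))
  left_triangle X := by
    have h : underMap (complFunctor 𝕜 κ) (toCompl X) ≫
        (show (complFunctor 𝕜 κ).obj (compl X) ⟶ (complFunctor 𝕜 κ).obj X from
          ObjectProperty.homMk (extendMor (isBanach_compl X) (𝟙 (compl X)))) =
        𝟙 ((complFunctor 𝕜 κ).obj X) := by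
      rw [underMap_complFunctor]
      refine ObjectProperty.hom_ext _ (compl_hom_ext (isBanach_compl X) ?_)
      refine (Category.assoc _ _ _).symm.trans ?_
      refine (congrArg (· ≫ extendMor (isBanach_compl X) (𝟙 (compl X)))
        (extendMor_toCompl (isBanach_compl (compl X)) (toCompl X ≫ toCompl (compl X)))).trans ?_
      refine (Category.assoc _ _ _).trans ?_
      exact congrArg (toCompl X ≫ ·) (extendMor_toCompl (isBanach_compl X) (𝟙 (compl X)))
    exact h
  right_triangle Y := by
    refine (congrArg (toCompl Y.obj ≫ ·) (underMap_inclusion _)).trans ?_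
    exact extendMor_toCompl Y.property (𝟙 Y.obj)

variable (𝕜 κ) in
/-- The completion `V`-monad. -/
def completionMonad : VMonad (NVec 𝕜 κ) (NVec 𝕜 κ) := (complAdjunction 𝕜 κ).toVMonad

/-- A morphism is dense if its range is dense. -/
def IsDense {X Y : NVec 𝕜 κ} (h : X ⟶ Y) : Prop := DenseRange (toLin h)

/-- A morphism is isometric if it preserves the seminorm. -/
def IsIsometric {X Y : NVec 𝕜 κ} (h : X ⟶ Y) : Prop := ∀ x, ‖toLin h x‖ = ‖x‖

end NVec

end NormedCompletion

end

open NormedCompletion NormedCompletion.NVec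

noncomputable section

namespace NormedCompletion

/-! ### Enriched orthogonality and reflections in a general `V`-category. -/

section Enriched

universe w v v₁ v₂ u₁ u₂

variable {V : Type v} [Category.{w} V] [MonoidalCategory V]
  {B : Type u₁} [Category.{v₁} B] [EnrichedOrdinaryCategory V B]
  {C : Type u₂} [Category.{v₂} C] [EnrichedOrdinaryCategory V C]

/-! Isomorphisms of seminormed or normed spaces with nonexpansive maps are the isometric bijections,
and one class of morphisms governs all four claims: the dense isometries. The core is that `h*` is
an isomorphism exactly when `h` is dense and isometric. If `h*` is an isomorphism, norming
functionals from Hahn–Banach, lifted along `h*` without change of norm, show that `h` is isometric,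
and a functional separating a point from the closure of the image shows that `h` is dense.
Conversely, bounded maps into any Banach space extend uniquely along a dense isometry, with the same
norm (`IsDense.vOrthogonal`).

Both monads then invert this class. Dual spaces are Banach, and a dense isometry from a Banach space
to a separated space is an isomorphism, so `h**` is invertible exactly when `h*` is. For completion,
density and isometry are transferred between `h` and its extension through the units, which are
themselves dense isometries.

If a reflective subcategory contains the scalars, its reflection units are orthogonal to the
scalars, hence are dense isometries. The unit at a Banach space is therefore orthogonal to its
source, as well as to its target, which forces it to be an isomorphism. The same cancellation
applied to the completion unit of `B` characterizes Banach spaces by orthogonality. -/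

lemma VOrthogonal.exists_lift {A₁ A₂ X : B} {f : A₁ ⟶ A₂} (h : VOrthogonal V f X) (g : A₁ ⟶ X) :
    ∃ k : A₂ ⟶ X, f ≫ k = g := by
  have : IsIso (eHomWhiskerRight V f X) := h
  -- Morphisms are global elements of hom-objects, and on these the whiskering is composition with
  -- `f`; the lift is the preimage of the element `g`.
  refine ⟨(eHomEquiv V).symm (eHomEquiv V g ≫ inv (eHomWhiskerRight V f X)),
    (eHomEquiv V).injective ?_⟩
  rw [← eHomEquiv_eHomWhiskerRight, Equiv.apply_symm_apply, Category.assoc, IsIso.inv_hom_id,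
    Category.comp_id]

lemma VOrthogonal.hom_ext {A₁ A₂ X : B} {f : A₁ ⟶ A₂} (h : VOrthogonal V f X) {k l : A₂ ⟶ X}
    (e : f ≫ k = f ≫ l) : k = l := by
  have : IsIso (eHomWhiskerRight V f X) := h
  apply (eHomEquiv V).injective
  rw [← cancel_mono (eHomWhiskerRight V f X), eHomEquiv_eHomWhiskerRight,
    eHomEquiv_eHomWhiskerRight, e]

/-- A morphism that is orthogonal to its source and to its target is an isomorphism. -/
lemma VOrthogonal.isIso {X Y : B} {f : X ⟶ Y} (hX : VOrthogonal V f X)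
    (hY : VOrthogonal V f Y) : IsIso f := by
  obtain ⟨r, hr⟩ := hX.exists_lift (𝟙 X)
  -- The retraction `r` comes from orthogonality to the source. Both `r ≫ f` and the identity extend
  -- `f` along itself, so orthogonality to the target identifies them.
  exact ⟨r, hr, hY.hom_ext (by rw [← Category.assoc, hr, Category.id_comp, Category.comp_id])⟩

/-- In a `V`-adjunction, the transposition `C(F X, Y) ⟶ B(X, G Y)` is an isomorphism. -/
lemma VAdjunction.isIso_transpose {F : EnrichedFunctor V B C} {G : EnrichedFunctor V C B}
    (adj : VAdjunction F G) (X : B) (Y : C) :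
    IsIso (G.map (F.obj X) Y ≫ eHomWhiskerRight V (adj.unit X) (G.obj Y)) := by
  -- The inverse is the usual one: apply `F`, then compose with the counit.
  refine ⟨F.map X (G.obj Y) ≫ eHomWhiskerLeft V (F.obj X) (adj.counit Y), ?_, ?_⟩
  · have h : G.map (F.obj X) Y ≫ F.map (G.obj (F.obj X)) (G.obj Y) ≫
        eHomWhiskerLeft V (F.obj (G.obj (F.obj X))) (adj.counit Y) =
          eHomWhiskerRight V (adj.counit (F.obj X)) Y :=
      (Category.assoc _ _ _).symm.trans
        ((adj.counit_natural (F.obj X) Y).trans (Category.id_comp _))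
    calc _ = G.map (F.obj X) Y ≫ (eHomWhiskerRight V (adj.unit X) (G.obj Y) ≫
          F.map X (G.obj Y)) ≫ eHomWhiskerLeft V (F.obj X) (adj.counit Y) := by
            simp only [Category.assoc]
      _ = G.map (F.obj X) Y ≫ F.map (G.obj (F.obj X)) (G.obj Y) ≫
          eHomWhiskerRight V (underMap F (adj.unit X)) (F.obj (G.obj Y)) ≫
            eHomWhiskerLeft V (F.obj X) (adj.counit Y) := by
            rw [eHomWhiskerRight_map, Category.assoc]
      -- Pre- and postcomposition commute, which brings the counit next to `F.map`, where its
      -- `V`-naturality `h` applies; a triangle identity remains.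
      _ = eHomWhiskerRight V (adj.counit (F.obj X)) Y ≫
            eHomWhiskerRight V (underMap F (adj.unit X)) Y := by
            rw [← eHom_whisker_exchange, ← h]
            simp only [Category.assoc]
      _ = 𝟙 _ := by
            rw [← eHomWhiskerRight_comp, adj.left_triangle, eHomWhiskerRight_id]
  · have h : F.map X (G.obj Y) ≫ G.map (F.obj X) (F.obj (G.obj Y)) ≫
        eHomWhiskerRight V (adj.unit X) (G.obj (F.obj (G.obj Y))) =
          eHomWhiskerLeft V X (adj.unit (G.obj Y)) :=
      (Category.assoc _ _ _).symm.trans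
        ((adj.unit_natural X (G.obj Y)).symm.trans (Category.id_comp _))
    calc _ = F.map X (G.obj Y) ≫ (eHomWhiskerLeft V (F.obj X) (adj.counit Y) ≫
          G.map (F.obj X) Y) ≫ eHomWhiskerRight V (adj.unit X) (G.obj Y) := by
            simp only [Category.assoc]
      _ = F.map X (G.obj Y) ≫ G.map (F.obj X) (F.obj (G.obj Y)) ≫
          eHomWhiskerLeft V (G.obj (F.obj X)) (underMap G (adj.counit Y)) ≫
            eHomWhiskerRight V (adj.unit X) (G.obj Y) := by
            rw [eHomWhiskerLeft_map, Category.assoc]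
      _ = eHomWhiskerLeft V X (adj.unit (G.obj Y)) ≫
            eHomWhiskerLeft V X (underMap G (adj.counit Y)) := by
            rw [eHom_whisker_exchange, ← h]
            simp only [Category.assoc]
      _ = 𝟙 _ := by
            rw [← eHomWhiskerLeft_comp, adj.right_triangle, eHomWhiskerLeft_id]

/-- The reflection morphisms are orthogonal to the objects of a reflective sub-`V`-category. -/
lemma VAdjunction.vOrthogonal_unit {P : ObjectProperty B}
    {K : EnrichedFunctor V B P.FullSubcategory} (adj : VAdjunction K (inclusion V P))
    (X : B) {Y : B} (hY : P Y) : VOrthogonal V (adj.unit X) Y := by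
  have h := adj.isIso_transpose X ⟨Y, hY⟩
  -- The inclusion is the identity on hom-objects, so transposition is just precomposition with the
  -- unit.
  have e : (inclusion V P).map (K.obj X) ⟨Y, hY⟩ ≫ eHomWhiskerRight V (adj.unit X) Y =
      eHomWhiskerRight V (adj.unit X) Y := Category.id_comp _
  exact (congrArg IsIso e).mp h

end Enriched

namespace NVec

variable {𝕜 : Type u} [RCLike 𝕜] {κ : Kind}

/-! ### Isometric and dense morphisms -/

lemma IsIsometric.isometry {X Y : NVec 𝕜 κ} {h : X ⟶ Y} (hi : IsIsometric h) :
    Isometry (toLin h) :=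
  AddMonoidHomClass.isometry_of_norm (toLin h) hi

lemma isIso_of_bijective_of_isIsometric {X Y : NVec 𝕜 κ} {h : X ⟶ Y}
    (hb : Function.Bijective (toLin h)) (hi : IsIsometric h) : IsIso h := by
  let e := LinearEquiv.ofBijective (toLin h) hb
  exact (mkIso e (fun x => (hi x).le) fun y =>
    ((hi (e.symm y)).symm.trans (congrArg norm (e.apply_symm_apply y))).le).isIso_hom

lemma toLin_inv_toLin {X Y : NVec 𝕜 κ} (h : X ⟶ Y) [IsIso h] (x : X) :
    toLin (inv h) (toLin h x) = x :=
  congrArg (fun t => toLin t x) (IsIso.hom_inv_id h)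

lemma toLin_toLin_inv {X Y : NVec 𝕜 κ} (h : X ⟶ Y) [IsIso h] (y : Y) :
    toLin h (toLin (inv h) y) = y :=
  congrArg (fun t => toLin t y) (IsIso.inv_hom_id h)

lemma bijective_of_isIso {X Y : NVec 𝕜 κ} (h : X ⟶ Y) [IsIso h] :
    Function.Bijective (toLin h) :=
  Function.bijective_iff_has_inverse.2 ⟨toLin (inv h), toLin_inv_toLin h, toLin_toLin_inv h⟩

lemma isIsometric_of_isIso {X Y : NVec 𝕜 κ} (h : X ⟶ Y) [IsIso h] : IsIsometric h := fun x =>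
  le_antisymm (norm_toLin_le h x)
    ((congrArg norm (toLin_inv_toLin h x)).symm.trans_le (norm_toLin_le (inv h) _))

lemma isDense_of_isIso {X Y : NVec 𝕜 κ} (h : X ⟶ Y) [IsIso h] : IsDense h :=
  (bijective_of_isIso h).2.denseRange

lemma isDense_toCompl (X : NVec 𝕜 κ) : IsDense (toCompl X) := denseRange_toCompl X

lemma isIsometric_toCompl (X : NVec 𝕜 κ) : IsIsometric (toCompl X) := fun x =>
  UniformSpace.Completion.norm_coe x

lemma continuous_toLin {X Y : NVec 𝕜 κ} (h : X ⟶ Y) : Continuous (toLin h) :=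
  (toCLM h).continuous

lemma IsDense.comp {X Y Z : NVec 𝕜 κ} {f : X ⟶ Y} {g : Y ⟶ Z} (hf : IsDense f)
    (hg : IsDense g) : IsDense (f ≫ g) :=
  show DenseRange (toLin g ∘ toLin f) from DenseRange.comp hg hf (continuous_toLin g)

lemma IsIsometric.comp {X Y Z : NVec 𝕜 κ} {f : X ⟶ Y} {g : Y ⟶ Z} (hf : IsIsometric f)
    (hg : IsIsometric g) : IsIsometric (f ≫ g) := fun x => (hg _).trans (hf x)

lemma IsDense.of_comp {X Y Z : NVec 𝕜 κ} {f : X ⟶ Y} {g : Y ⟶ Z} (h : IsDense (f ≫ g)) :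
    IsDense g :=
  h.mono (Set.range_comp_subset_range (toLin f) (toLin g))

/-- An isometric map induces the topology of its source even when it is not injective, so closures
in `Y` are preimages of closures in `Z`. -/
lemma IsDense.of_comp_isIsometric {X Y Z : NVec 𝕜 κ} {f : X ⟶ Y} {g : Y ⟶ Z}
    (h : IsDense (f ≫ g)) (hg : IsIsometric g) : IsDense f := by
  intro y
  rw [hg.isometry.isUniformInducing.isInducing.closure_eq_preimage_closure_image,
    ← Set.range_comp]
  exact h (toLin g y)

lemma IsIsometric.of_comp {X Y Z : NVec 𝕜 κ} {f : X ⟶ Y} {g : Y ⟶ Z}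
    (h : IsIsometric (f ≫ g)) : IsIsometric f := fun x =>
  le_antisymm (norm_toLin_le f x) ((h x).symm.trans_le (norm_toLin_le g _))

/-- Preserving the seminorm is a closed condition on `y`, so it suffices to check it on the image of
`f`. -/
lemma IsDense.isIsometric_of_comp {X Y Z : NVec 𝕜 κ} {f : X ⟶ Y} {g : Y ⟶ Z} (hd : IsDense f)
    (hf : IsIsometric f) (h : IsIsometric (f ≫ g)) : IsIsometric g := fun y => by
  refine hd.induction_on (p := fun y => ‖toLin g y‖ = ‖y‖) y
    (isClosed_eq (continuous_toLin g).norm continuous_norm) fun x => ?_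
  exact (h x).trans (hf x).symm

/-- A dense isometric morphism from a complete space to a separated space is an isomorphism. -/
lemma IsDense.isIso {X Y : NVec 𝕜 κ} {h : X ⟶ Y} (hd : IsDense h) (hi : IsIsometric h)
    (hX : IsBanach X) (hY : ∀ y : Y, ‖y‖ = 0 → y = 0) : IsIso h := by
  have := hX.1
  have : T0Space Y := (NormedAddCommGroup.ofSeparation hY).toMetricSpace.instT0Space
  -- The image is complete, and a complete subset of a separated space is closed; with density, `h`
  -- is onto.
  have hc : IsClosed (Set.range (toLin h)) :=
    hi.isometry.isUniformInducing.isComplete_range.isClosed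
  refine isIso_of_bijective_of_isIsometric ⟨?_, ?_⟩ hi
  -- Isometry only gives kernel elements seminorm zero; separation of `X` makes them vanish.
  · refine (injective_iff_map_eq_zero (toLin h)).2 fun x hx => hX.2 x ?_
    rw [← hi x, hx, norm_zero]
  · exact Set.range_eq_univ.1 (hc.closure_eq.symm.trans hd.closure_range)

lemma isBanach_of_isIso {X Y : NVec 𝕜 κ} (h : X ⟶ Y) [IsIso h] (hX : IsBanach X) :
    IsBanach Y := by
  have := hX.1
  have hi := isIsometric_of_isIso (inv h)
  refine ⟨?_, fun y hy => ?_⟩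
  · rw [completeSpace_iff_isComplete_range hi.isometry.isUniformInducing,
      (bijective_of_isIso (inv h)).2.range_eq]
    exact completeSpace_iff_isComplete_univ.1 hX.1
  · refine (bijective_of_isIso (inv h)).1 ?_
    rw [map_zero]
    exact hX.2 _ ((hi y).trans hy)

lemma isBanach_scalars : IsBanach (scalars 𝕜 κ) :=
  ⟨inferInstanceAs (CompleteSpace 𝕜), fun x => norm_eq_zero (E := 𝕜) (a := x).1⟩

/-- Completeness and separation come from the scalars alone; `X` may be incomplete or merely
seminormed. -/
lemma isBanach_dualObj (X : NVec 𝕜 κ) : IsBanach (dualObj X) :=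
  ⟨inferInstanceAs (CompleteSpace (X →L[𝕜] 𝕜)),
    fun φ hφ => ContinuousLinearMap.ext fun x => (norm_le_zero_iff (E := 𝕜)).1 <|
      ((homVal φ).le_opNorm x).trans_eq ((congrArg (· * ‖x‖) hφ).trans (zero_mul _))⟩

/-! ### Orthogonality -/

/-- Dense isometric morphisms are orthogonal to Banach spaces. -/
lemma IsDense.vOrthogonal {X Y B : NVec 𝕜 κ} {h : X ⟶ Y} (hd : IsDense h)
    (hi : IsIsometric h) (hB : IsBanach B) : VOrthogonal (NVec 𝕜 κ) h B := by
  have := hB.1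
  have := hB.t0Space
  have hd' : DenseRange (toCLM h) := hd
  have hu : IsUniformInducing (toCLM h) := hi.isometry.isUniformInducing
  refine isIso_of_bijective_of_isIsometric ⟨?_, fun φ => ?_⟩ fun φ => ?_
  · intro φ ψ e
    rw [eHomWhiskerRight_apply h B φ, eHomWhiskerRight_apply h B ψ] at e
    refine ContinuousLinearMap.coeFn_injective (hd'.equalizer (homVal φ).continuous
      (homVal ψ).continuous (funext fun x => ?_))
    exact congrArg (fun t : X →L[𝕜] B => t x) e
  -- Surjectivity: extension by continuity along a dense map that induces the uniformity of its
  -- source.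
  · refine ⟨(homVal φ).extend (toCLM h), ?_⟩
    rw [eHomWhiskerRight_apply h B]
    exact ContinuousLinearMap.ext fun x => (homVal φ).extend_eq hd' hu x
  · refine le_antisymm (norm_toLin_le _ _) ?_
    rw [eHomWhiskerRight_apply h B φ]
    -- The bound by the norm of the restriction is a closed condition, so it is checked on the image
    -- of `h`, where isometry turns `‖x‖` into `‖h x‖`.
    refine ContinuousLinearMap.opNorm_le_bound (homVal φ) (norm_nonneg _) fun y => ?_
    refine hd'.induction_on (p := fun y => ‖homVal φ y‖ ≤ _ * ‖y‖) y
      (isClosed_le (homVal φ).continuous.norm (continuous_const.mul continuous_norm)) fun x => ?_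
    refine (((homVal φ).comp (toCLM h)).le_opNorm x).trans_eq ?_
    exact congrArg (_ * ·) (hi x).symm

/-- A functional of norm at most one attaining `‖x‖` at `x` is `ψ ∘ h` for some `ψ` of the same
norm, whence `‖x‖ ≤ ‖h x‖`. -/
lemma isIsometric_of_isIso_dualHom {X Y : NVec 𝕜 κ} {h : X ⟶ Y} [IsIso (dualHom h)] :
    IsIsometric h := fun x => by
  refine le_antisymm (norm_toLin_le h x) ?_
  obtain ⟨φ, hφ, hx⟩ := exists_dual_vector'' 𝕜 (x : X)
  obtain ⟨ψ, rfl⟩ := (bijective_of_isIso (dualHom h)).2 φ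
  have hψ : ‖homVal ψ‖ ≤ 1 := (isIsometric_of_isIso (dualHom h) ψ).symm.trans_le hφ
  have hx' : homVal ψ (toLin h x) = (‖x‖ : 𝕜) := hx
  calc ‖x‖ = ‖homVal ψ (toLin h x)‖ :=
        ((congrArg norm hx').trans ((RCLike.norm_ofReal (K := 𝕜) _).trans (abs_norm x))).symm
    _ ≤ ‖homVal ψ‖ * ‖toLin h x‖ := (homVal ψ).le_opNorm _
    _ ≤ ‖toLin h x‖ := mul_le_of_le_one_left (norm_nonneg _) hψ

/-- Only injectivity of `h*` matters: a functional that vanishes on the image but not at `y` would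
be a nonzero element of its kernel. -/
lemma isDense_of_isIso_dualHom {X Y : NVec 𝕜 κ} {h : X ⟶ Y} [IsIso (dualHom h)] :
    IsDense h := by
  intro y
  by_contra hy
  let S : Submodule 𝕜 Y := LinearMap.range (toLin h)
  -- The image `S` need not be closed; the quotient seminorm vanishes exactly on its closure, so
  -- Hahn–Banach can be applied in the seminormed quotient.
  have hy' : ‖S.mkQ y‖ ≠ 0 := fun e =>
    hy (QuotientAddGroup.norm_mk_eq_zero_iff_mem_closure (S := S.toAddSubgroup).1 e)
  obtain ⟨g, -, hg⟩ := exists_dual_vector 𝕜 (S.mkQ y) hy'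
  let ψ : Y →L[𝕜] 𝕜 := g.comp S.mkQL
  have hψ : ψ = 0 := (bijective_of_isIso (dualHom h)).1 <| by
    refine Eq.trans (ContinuousLinearMap.ext fun x => ?_) (map_zero (toLin (dualHom h))).symm
    have : S.mkQ (toLin h x) = 0 := (Submodule.Quotient.mk_eq_zero S).2 ⟨x, rfl⟩
    exact (congrArg g this).trans (map_zero g)
  have h0 : g (S.mkQ y) = 0 := congrArg (fun t : Y →L[𝕜] 𝕜 => t y) hψ
  exact hy' (RCLike.ofReal_eq_zero.1 (hg.symm.trans h0))

lemma vOrthogonal_scalars_iff_isIso_dualHom {X Y : NVec 𝕜 κ} (h : X ⟶ Y) :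
    VOrthogonal (NVec 𝕜 κ) h (scalars 𝕜 κ) ↔ IsIso (dualHom h) := by
  rw [VOrthogonal, show eHomWhiskerRight (NVec 𝕜 κ) h (scalars 𝕜 κ) = dualHom h from
    hom_ext fun ψ => (eHomWhiskerRight_apply h (scalars 𝕜 κ) ψ).trans (dualHom_apply h ψ).symm]

lemma vOrthogonal_scalars_iff {X Y : NVec 𝕜 κ} (h : X ⟶ Y) :
    VOrthogonal (NVec 𝕜 κ) h (scalars 𝕜 κ) ↔ IsDense h ∧ IsIsometric h :=
  ⟨fun H => by
    have := (vOrthogonal_scalars_iff_isIso_dualHom h).1 H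
    exact ⟨isDense_of_isIso_dualHom, isIsometric_of_isIso_dualHom⟩,
  fun H => H.1.vOrthogonal H.2 isBanach_scalars⟩

lemma isIso_dualHom_iff {X Y : NVec 𝕜 κ} (h : X ⟶ Y) :
    IsIso (dualHom h) ↔ IsDense h ∧ IsIsometric h :=
  (vOrthogonal_scalars_iff_isIso_dualHom h).symm.trans (vOrthogonal_scalars_iff h)

/-! ### The morphisms inverted by the two monads -/

lemma underMap_doubleDualMonad {X Y : NVec 𝕜 κ} (h : X ⟶ Y) :
    underMap (doubleDualMonad 𝕜 κ).T h = dualHom (dualHom h) := by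
  refine (underMap_comp_functor (dualOp 𝕜 κ) (dual 𝕜 κ) h).trans ?_
  rw [underMap_dualOp]
  exact underMap_dual (dualHom h)

/-- Applying the criterion for dual maps to `h*` shows that if `h**` is invertible then `h*` is a
dense isometry; being a map between Banach spaces, it is then invertible, and the criterion applies
again to `h`. -/
lemma inverted_doubleDualMonad_iff {X Y : NVec 𝕜 κ} (h : X ⟶ Y) :
    (doubleDualMonad 𝕜 κ).inverted h ↔ IsDense h ∧ IsIsometric h := by
  rw [← isIso_dualHom_iff, VMonad.inverted, underMap_doubleDualMonad]
  refine ⟨fun H => ?_, fun H => ?_⟩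
  · obtain ⟨hd, hi⟩ := (isIso_dualHom_iff (dualHom h)).1 H
    exact hd.isIso hi (isBanach_dualObj Y) (isBanach_dualObj X).2
  · exact (isIso_dualHom_iff (dualHom h)).2
      ⟨isDense_of_isIso (dualHom h), isIsometric_of_isIso (dualHom h)⟩

lemma underMap_completionMonad {X Y : NVec 𝕜 κ} (h : X ⟶ Y) :
    underMap (completionMonad 𝕜 κ).T h = extendMor (isBanach_compl Y) (h ≫ toCompl Y) := by
  refine (underMap_comp_functor (complFunctor 𝕜 κ)
    (inclusion (NVec 𝕜 κ) (IsBanach (𝕜 := 𝕜) (κ := κ))) h).trans ?_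
  rw [underMap_complFunctor]
  exact underMap_inclusion _

lemma inverted_completionMonad_iff {X Y : NVec 𝕜 κ} (h : X ⟶ Y) :
    (completionMonad 𝕜 κ).inverted h ↔ IsDense h ∧ IsIsometric h := by
  have e := extendMor_toCompl (isBanach_compl Y) (h ≫ toCompl Y)
  rw [VMonad.inverted, underMap_completionMonad]
  refine ⟨fun H => ?_, fun ⟨hd, hi⟩ => ?_⟩
  -- In the naturality square `e` all sides but `h` are dense isometries; the isometric unit of `Y`
  -- can be cancelled.
  · have H' : IsIso (extendMor (isBanach_compl Y) (h ≫ toCompl Y)) := H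
    have hd : IsDense (h ≫ toCompl Y) := e ▸ (isDense_toCompl X).comp (isDense_of_isIso _)
    have hi : IsIsometric (h ≫ toCompl Y) :=
      e ▸ (isIsometric_toCompl X).comp (isIsometric_of_isIso _)
    exact ⟨hd.of_comp_isIsometric (isIsometric_toCompl Y), hi.of_comp⟩
  -- Cancelling the dense isometric unit of `X` instead makes the extension a dense isometry between
  -- Banach spaces.
  · have hd' : IsDense (toCompl X ≫ extendMor (isBanach_compl Y) (h ≫ toCompl Y)) :=
      e.symm ▸ hd.comp (isDense_toCompl Y)
    have hi' : IsIsometric (toCompl X ≫ extendMor (isBanach_compl Y) (h ≫ toCompl Y)) :=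
      e.symm ▸ hi.comp (isIsometric_toCompl Y)
    exact hd'.of_comp.isIso ((isDense_toCompl X).isIsometric_of_comp (isIsometric_toCompl X) hi')
      (isBanach_compl X) (isBanach_compl Y).2

lemma isIso_toCompl {X : NVec 𝕜 κ} (hX : IsBanach X) : IsIso (toCompl X) :=
  (isDense_toCompl X).isIso (isIsometric_toCompl X) hX (isBanach_compl X).2

/-- The unit at an already complete space is invertible, and the multiplication is a one-sided
inverse of it. -/
lemma isIdempotent_completionMonad : (completionMonad 𝕜 κ).IsIdempotent := fun X => by
  have h : toCompl (compl X) ≫ (completionMonad 𝕜 κ).mul X = 𝟙 (compl X) :=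
    (completionMonad 𝕜 κ).unit_mul X
  have : IsIso (toCompl (compl X)) := isIso_toCompl (isBanach_compl X)
  exact @IsIso.of_isIso_fac_left (NVec 𝕜 κ) _ (compl X) (compl (compl X)) (compl X) _ _ _ this
    inferInstance h

lemma isIdempotentCore_completionMonad :
    IsIdempotentCore (completionMonad 𝕜 κ) (doubleDualMonad 𝕜 κ) :=
  ⟨isIdempotent_completionMonad, MorphismProperty.ext _ _ fun _ _ h =>
    (inverted_completionMonad_iff h).trans (inverted_doubleDualMonad_iff h).symm⟩

/-! ### Banach spaces as a reflective hull and as an orthogonal class -/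

lemma isVReflective_isBanach : IsVReflective (NVec 𝕜 κ) (IsBanach (𝕜 := 𝕜) (κ := κ)) :=
  ⟨⟨fun e hX => isBanach_of_isIso e.hom hX⟩, complFunctor 𝕜 κ, ⟨complAdjunction 𝕜 κ⟩⟩

lemma isVReflectiveHull_isBanach :
    IsVReflectiveHull (NVec 𝕜 κ) (fun X : NVec 𝕜 κ => X = scalars 𝕜 κ) IsBanach := by
  refine ⟨isVReflective_isBanach, ?_, ?_⟩
  · rintro X rfl
    exact isBanach_scalars
  · rintro P ⟨hP, K, ⟨adj⟩⟩ hQ X hX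
    obtain ⟨hd, hi⟩ := (vOrthogonal_scalars_iff (adj.unit X)).1
      (adj.vOrthogonal_unit X (hQ _ rfl))
    -- The unit is orthogonal to its source `X`, a Banach space, and to its target, which lies in
    -- `P`; repleteness then puts `X` in `P`.
    have := (hd.vOrthogonal hi hX).isIso (adj.vOrthogonal_unit X (K.obj X).property)
    exact hP.of_iso (asIso (adj.unit X)).symm (K.obj X).property

lemma isBanach_iff_forall_vOrthogonal (B : NVec 𝕜 κ) :
    IsBanach B ↔ ∀ (X Y : NVec 𝕜 κ) (h : X ⟶ Y),
      VOrthogonal (NVec 𝕜 κ) h (scalars 𝕜 κ) → VOrthogonal (NVec 𝕜 κ) h B := by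
  refine ⟨fun hB X Y h H => ?_, fun H => ?_⟩
  · obtain ⟨hd, hi⟩ := (vOrthogonal_scalars_iff h).1 H
    exact hd.vOrthogonal hi hB
  -- The completion unit of `B` is the only test morphism needed: it is orthogonal to `B` by
  -- hypothesis and to its completion because that is Banach.
  · have hB := H _ _ (toCompl B)
      ((isDense_toCompl B).vOrthogonal (isIsometric_toCompl B) isBanach_scalars)
    have : IsIso (toCompl B) := hB.isIso
      ((isDense_toCompl B).vOrthogonal (isIsometric_toCompl B) (isBanach_compl B))
    exact isBanach_of_isIso (inv (toCompl B)) (isBanach_compl B)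

/-- Hypotheses and conclusions match separately: whiskering into the scalars is `h*`, and whiskering
into `B` is the internal-hom action `MonoidalClosed.pre`. -/
lemma vOrthogonal_imp_iff (B : NVec 𝕜 κ) {X Y : NVec 𝕜 κ} (h : X ⟶ Y) :
    (VOrthogonal (NVec 𝕜 κ) h (scalars 𝕜 κ) → VOrthogonal (NVec 𝕜 κ) h B) ↔
      (IsIso (underMap (dual 𝕜 κ) h.op) → IsIso ((MonoidalClosed.pre h).app B)) := by
  rw [vOrthogonal_scalars_iff_isIso_dualHom, underMap_dual, VOrthogonal,
    MonoidalClosed.enrichedOrdinaryCategorySelf_eHomWhiskerRight]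
  rfl

end NVec

end NormedCompletion

end

open NormedCompletion NormedCompletion.NVec
theorem mainTheorem7 (𝕜 : Type u) [RCLike 𝕜] (κ : Kind) :
    IsIdempotentCore (completionMonad 𝕜 κ) (doubleDualMonad 𝕜 κ) ∧
    (∀ (X Y : NVec 𝕜 κ) (h : X ⟶ Y),
      ((doubleDualMonad 𝕜 κ).inverted h ↔ IsDense h ∧ IsIsometric h) ∧
      ((completionMonad 𝕜 κ).inverted h ↔ IsDense h ∧ IsIsometric h)) ∧
    IsVReflectiveHull (NVec 𝕜 κ) (fun X : NVec 𝕜 κ => X = scalars 𝕜 κ) IsBanach ∧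
    (∀ B : NVec 𝕜 κ,
      (∀ (X Y : NVec 𝕜 κ) (h : X ⟶ Y),
        (VOrthogonal (NVec 𝕜 κ) h (scalars 𝕜 κ) → VOrthogonal (NVec 𝕜 κ) h B) ↔
          (IsIso (underMap (dual 𝕜 κ) h.op) → IsIso ((MonoidalClosed.pre h).app B))) ∧
      (IsBanach B ↔ ∀ (X Y : NVec 𝕜 κ) (h : X ⟶ Y),
        VOrthogonal (NVec 𝕜 κ) h (scalars 𝕜 κ) → VOrthogonal (NVec 𝕜 κ) h B) ∧
      (IsBanach B ↔ ∀ (X Y : NVec 𝕜 κ) (h : X ⟶ Y),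
        IsIso (underMap (dual 𝕜 κ) h.op) → IsIso ((MonoidalClosed.pre h).app B))) := by
  refine ⟨isIdempotentCore_completionMonad,
    fun X Y h => ⟨inverted_doubleDualMonad_iff h, inverted_completionMonad_iff h⟩,
    isVReflectiveHull_isBanach, fun B => ⟨fun X Y h => vOrthogonal_imp_iff B h,
      isBanach_iff_forall_vOrthogonal B, ?_⟩⟩
  simp only [← vOrthogonal_imp_iff]
  exact isBanach_iff_forall_vOrthogonal B
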